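/- **Setting.** Time is real. A task is $\tau_i=(T_i,L_i,C_i^L,C_i^H,D_i,D_i^L)$: minimum separation $T_i$, level $L_i\in\{LC,HC\}$, WCETs $C_i^L,C_i^H$, deadline $D_i$, and deadline $D_i^L$ used in $LC$ mode. Here $0<C_i^L\le D_i^L\le D_i\le T_i$ and $C_i^H\le D_i$; $C_i^L<C_i^H$ if $L_i=HC$; $C_i^L=C_i^H$ and $D_i^L=D_i$ if $L_i=LC$. A component $\mathbb C$ is a finite set of tasks with a tolerance limit $TL\in\mathbb N$ ($TL=0$ if all its tasks are $LC$; it is then an $LC$ component, otherwise an $HC$ component). An $HC$ task switches to $HC$ mode at the latest when one of its jobs has executed for $C_i^L$ and needs more (an interface task representing a child component may switch earlier). The first such switch is the internal mode switch (IMS), and the $(TL+1)$st is the external mode switch (EMS). At the IMS (or at an earlier EMS of another component) the $LC$ tasks of $\mathbb C$ are dropped; at the EMS all $HC$ tasks of $\mathbb C$ enter $HC$ mode. Jobs are scheduled by preemptive EDF within the supplied time, using $D_i^L$ for $HC$ tasks in $LC$ mode and $D_i$ otherwise. An MCPR interface $\mathbb I=(T,L,\{C^L,C^H\})$, $0\le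 C^L\le C^H\le T$, $T>0$, has the level of $\mathbb C$ and supplies, in each period of length $T$ (of arbitrary phase), at least $C^L$ units. It supplies at least $C^H$ units in every period that starts after the EMS, and also in the period that contains the EMS if fewer than $C^L$ units of that period have been supplied by then. **Schedulable in $HC$ mode under $\mathbb I$** means: in every run of $\mathbb C$ in which the EMS occurs and the supply follows $\mathbb I$, every $HC$ job completes by its deadline, every $LC$ job whose deadline is not after the drop instant completes by it, and every job of an $HC$ task whose tightened deadline is not after the task's entry into $HC$ mode has by then received the smaller of its demand and $C_i^L$. **Demand.** For a task and $0\le t_i\le t$ put $$A(r)=\begin{cases}C_i^L,& r+D_i^L<t_i\\ C_i^H,& r+D_i^L\ge t_i,\ r+D_i\le t\\ \min\{t_i-r,C_i^L\},& t_i\le r+D_i^L\le t<r+D_i\\ 0,& r+D_i^L>t,\end{cases}$$ and $B(r)=\min\{t_i-r,C_i^L\}$ if $r+D_i^L\le t$, $B(r)=0$ otherwise. With $m=\lfloor t_i/T_i\rfloor$, $o=t-D_i-\lfloor (t-D_i)/T_i\rfloor T_i$, $b=\lfloor (t_i-o)/T_i\rfloor$, $a=\lfloor (t-D_i)/T_i\rfloor-b$,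 let $d_a=mC_i^L+B(mT_i)$, $d_b=mC_i^L+A(mT_i)$, $d_c=bC_i^L+A(o+bT_i)+aC_i^H$. Then $\mathrm{dbf}(\tau_i,t,t_i)$ is $d_a$ for an $LC$ task, and for an $HC$ task it is $d_b$ if $t-t_i<D_i-D_i^L$, $d_c$ if $t-t_i\ge D_i$, and $\max\{d_b,d_c\}$ otherwise. With $\Delta_i=\max\{0,\mathrm{dbf}(\tau_i,t,t_I)-\mathrm{dbf}(\tau_i,t,t_E)\}$, $$\mathrm{dbf}(\mathbb C,t,t_E,t_I)=\sum_{L_i=HC}\mathrm{dbf}(\tau_i,t,t_E)+\big(\text{sum of the } TL \text{ largest } \Delta_i,\ L_i=HC\big)+\sum_{L_i=LC}\mathrm{dbf}(\tau_i,t,t_I).$$ **Supply.** Write $[x]_0=\max\{0,x\}$. For $t_E=t$, $\mathrm{sbf}_{\mathbb I}(t_E,t)=nC^L+[t-2(T-C^L)-nT]_0$ with $n=[\lfloor (t-T+C^L)/T\rfloor]_0$. For $t_E<t$, $\mathrm{sbf}_{\mathbb I}(t_E,t)=\min\{S_A,S_B\}$, as follows. *Pattern A:* $s_1=T-C^L$,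 $n_E=[\lfloor (t_E-s_1)/T\rfloor]_0$, $n=[\lfloor (t-s_1)/T\rfloor]_0$, $s_E=n_ET+s_1$, $e_E=s_E+T$, $e=nT+T+s_1$, $\ell=[t-(2T-C^L-C^H)-nT]_0$; $S_A$ equals $n_EC^L+(n-n_E)C^H+\ell$ if $t_E-s_E<C^L$; otherwise it equals $(n_E+1)C^L+(n-n_E-1)C^H+\ell$ if $e\ne e_E$, and $n_EC^L+\min\{C^L,\ell\}$ if $e=e_E$. *Pattern B:* $s_1=T-C^L-(\lceil t_E/T\rceil T-t_E)$, $n_E=\lfloor (t_E-s_1)/T\rfloor$, $n=[\lfloor (t-s_1)/T\rfloor]_0$, $e_E=t_E-C^L+T$, $e=nT+T+s_1$, $\ell=[t-s_1-(T-C^H)-nT]_0$; $S_B$ equals $(n_E+1)C^L+(n-n_E-1)C^H+\ell$ if $e\ne e_E$, and $n_EC^L+\min\{C^L,\ell\}$ if $e=e_E$. **The bound $t_{MAX}$.** Let $U_L^L=\sum_{L_i=LC}C_i^L/T_i$, $U_H^L=\sum_{L_i=HC}C_i^L/T_i$, $U_H^H=\sum_{L_i=HC}C_i^H/T_i$; let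 $V$ be the sum of the $TL$ largest $(C_i^H-C_i^L)/T_i$ over $HC$ tasks; let $K=\sum_{L_i=LC}C_i^L+\sum_{L_i=HC}C_i^H(2T_i-D_i)/T_i$ and $c=\frac{C^H}{T}(2T-C^H)-\frac{(C^L)^2}{T}$; let $$\sigma=\min\Big\{\tfrac{C^H}{T}-U_H^H,\ \tfrac{C^L}{T}-U_H^L-V,\ \tfrac{C^L}{T}-U_L^L-U_H^L\Big\}.$$ Put $t_{MAX}=(K+c)/\sigma$ if $\sigma>0$ and $t_{MAX}=\infty$ otherwise. **Theorem.** If for all $t$ with $0\le t\le t_{MAX}$, all $t_E$ with $0\le t_E\le t$ and all $t_I$ with $0\le t_I\le t_E$, $$\mathrm{dbf}(\mathbb C,t,t_E,t_I)\le \mathrm{sbf}_{\mathbb I}(t_E,t),$$ then $\mathbb C$ is schedulable in $HC$ mode under $\mathbb I$. -/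

import Mathlib

open MeasureTheory Set

noncomputable section

namespace MixedCriticality

/-- The two criticality levels: low (`LC`) and high (`HC`). -/
inductive Level
  | LC
  | HC
  deriving DecidableEq

/-- A constrained-deadline mixed-criticality sporadic task: minimum separation `T`, criticality
level, `LC` and `HC` worst-case execution times `CL`, `CH`, relative deadline `D`, and the
tightened relative deadline `DL` that is used while the task is in `LC` mode. -/
structure Task where
  T : ℝ
  level : Level
  CL : ℝ
  CH : ℝ
  D : ℝ
  DL : ℝ
  CL_pos : 0 < CL
  CL_le_DL : CL ≤ DL
  DL_le_D : DL ≤ D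
  CH_le_D : CH ≤ D
  D_le_T : D ≤ T
  CL_lt_CH_of_HC : level = Level.HC → CL < CH
  CL_eq_CH_of_LC : level = Level.LC → CL = CH
  DL_eq_D_of_LC : level = Level.LC → DL = D

/-- A component: a finite workload of tasks (indexed by `ι`) and an `HC` tolerance limit `TL`.
It is an `LC` component if all its tasks are `LC` tasks, and then `TL = 0`. -/
structure Component (ι : Type*) where
  task : ι → Task
  TL : ℕ
  TL_eq_zero : (∀ i, (task i).level = Level.LC) → TL = 0

/-- A mixed-criticality periodic resource: period `T`, criticality level, and resource
capacities `CL`, `CH` per period in `LC` and in `HC` mode. -/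
structure MCPR where
  T : ℝ
  level : Level
  CL : ℝ
  CH : ℝ
  T_pos : 0 < T
  CL_nonneg : 0 ≤ CL
  CL_le_CH : CL ≤ CH
  CH_le_T : CH ≤ T

/-! ### Demand bound functions -/

namespace Task

variable (τ : Task)

/-- Demand in `[0, t)` of the last job that an `HC` task releases (at `r`) before it switches to
`HC` mode at `ti`. -/
def dbfJobA (t ti r : ℝ) : ℝ :=
  if r + τ.DL < ti then τ.CL
  else if r + τ.D ≤ t then τ.CH
  else if r + τ.DL ≤ t then min (ti - r) τ.CL
  else 0

/-- Demand in `[0, t)` of the last job that an `LC` task releases (at `r`) before it is dropped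
at `ti`. -/
def dbfJobB (t ti r : ℝ) : ℝ :=
  if r + τ.DL ≤ t then min (ti - r) τ.CL else 0

/-- `LC` task: first release at `0`, then as soon as possible. -/
def dbfA (t ti : ℝ) : ℝ :=
  (⌊ti / τ.T⌋ : ℝ) * τ.CL + τ.dbfJobB t ti ((⌊ti / τ.T⌋ : ℝ) * τ.T)

/-- `HC` task, first release at `0`, then as soon as possible. -/
def dbfB (t ti : ℝ) : ℝ :=
  (⌊ti / τ.T⌋ : ℝ) * τ.CL + τ.dbfJobA t ti ((⌊ti / τ.T⌋ : ℝ) * τ.T)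

/-- `t - D - ⌊(t - D) / T⌋ * T`: the first release of the pattern in which a deadline falls
on `t`. -/
def offset (t : ℝ) : ℝ := t - τ.D - (⌊(t - τ.D) / τ.T⌋ : ℝ) * τ.T

/-- Index of the last release up to `ti` in the pattern in which a deadline falls on `t`. -/
def bNum (t ti : ℝ) : ℤ := ⌊(ti - τ.offset t) / τ.T⌋

/-- Number of later jobs in that pattern. -/
def aNum (t ti : ℝ) : ℤ := ⌊(t - τ.D) / τ.T⌋ - τ.bNum t ti

/-- `HC` task, releases such that a deadline falls on `t`. -/
def dbfC (t ti : ℝ) : ℝ :=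
  (τ.bNum t ti : ℝ) * τ.CL + τ.dbfJobA t ti (τ.offset t + (τ.bNum t ti : ℝ) * τ.T)
    + (τ.aNum t ti : ℝ) * τ.CH

/-- Demand bound of a task for an interval of length `t`, when it switches to `HC` mode
(`HC` task) or is dropped (`LC` task) at `ti`. -/
def dbf (t ti : ℝ) : ℝ :=
  match τ.level with
  | Level.LC => τ.dbfA t ti
  | Level.HC =>
    if t - ti < τ.D - τ.DL then τ.dbfB t ti
    else if τ.D ≤ t - ti then τ.dbfC t ti
    else max (τ.dbfB t ti) (τ.dbfC t ti)

end Task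

namespace Component

variable {ι : Type*} [Fintype ι] (C : Component ι)

def hcTasks : Finset ι := Finset.univ.filter fun i => (C.task i).level = Level.HC

def lcTasks : Finset ι := Finset.univ.filter fun i => (C.task i).level = Level.LC

/-- A component is an `LC` component if all its tasks are `LC` tasks, else an `HC` component. -/
def level : Level := if C.hcTasks.card = 0 then Level.LC else Level.HC

/-- The largest sum of `f` over at most `TL` of the `HC` tasks: for nonnegative `f`, the sum of
its `TL` largest values. -/
def topSum (f : ι → ℝ) : ℝ :=
  (C.hcTasks.powerset.filter fun G => G.card ≤ C.TL).sup'
    ⟨∅, by simp⟩ fun G => ∑ i ∈ G, f i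

/-- Demand bound of a component for an interval of length `t`, with external mode switch at `tE`
and internal mode switch at `tI`. -/
def dbf (t tE tI : ℝ) : ℝ :=
  (∑ i ∈ C.hcTasks, (C.task i).dbf t tE)
    + C.topSum (fun i => max 0 ((C.task i).dbf t tI - (C.task i).dbf t tE))
    + ∑ i ∈ C.lcTasks, (C.task i).dbf t tI

end Component

/-! ### Supply bound function -/

namespace MCPR

variable (I : MCPR)

/-- Supply bound when there is no external mode switch within the interval. -/
def sbfLC (t : ℝ) : ℝ :=
  let n : ℝ := (max 0 ⌊(t - (I.T - I.CL)) / I.T⌋ : ℤ)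
  n * I.CL + max 0 (t - 2 * (I.T - I.CL) - n * I.T)

/-- Worst-case supply pattern A. -/
def sbfA (tE t : ℝ) : ℝ :=
  let nE : ℝ := (max 0 ⌊(tE - (I.T - I.CL)) / I.T⌋ : ℤ)
  let n : ℝ := (max 0 ⌊(t - (I.T - I.CL)) / I.T⌋ : ℤ)
  let sE := nE * I.T + I.T - I.CL
  let eE := sE + I.T
  let e := n * I.T + 2 * I.T - I.CL
  let last := max 0 (t - (2 * I.T - I.CL - I.CH) - n * I.T)
  if tE - sE < I.CL then nE * I.CL + (n - nE) * I.CH + last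
  else if e ≠ eE then (nE + 1) * I.CL + (n - nE - 1) * I.CH + last
  else nE * I.CL + min I.CL last

/-- Worst-case supply pattern B: pattern A shifted so that the period in which the external mode
switch occurs starts at `tE - CL`. For `tE > 0` one has `tE ≥ s1`, so `nE` is nonnegative; for
`tE = 0` there is no shift, the switch precedes `s1`, and `nE` may be `-1`. -/
def sbfB (tE t : ℝ) : ℝ :=
  let xE : ℝ := (⌈tE / I.T⌉ : ℝ) * I.T
  let s1 := I.T - I.CL - (xE - tE)
  let nE : ℝ := (⌊(tE - s1) / I.T⌋ : ℤ)
  let n : ℝ := (max 0 ⌊(t - s1) / I.T⌋ : ℤ)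
  let eE := tE - I.CL + I.T
  let e := n * I.T + I.T + s1
  let last := max 0 (t - s1 - (I.T - I.CH) - n * I.T)
  if e ≠ eE then (nE + 1) * I.CL + (n - nE - 1) * I.CH + last
  else nE * I.CL + min I.CL last

/-- Supply bound for an interval of length `t` with external mode switch at `tE ≤ t`; `tE = t`
means that no switch occurs within the interval. -/
def sbf (tE t : ℝ) : ℝ :=
  if tE = t then I.sbfLC t else min (I.sbfA tE t) (I.sbfB tE t)

end MCPR

/-! ### Bound on the interval lengths to be tested -/

namespace Component

variable {ι : Type*} [Fintype ι] (C : Component ι) (I : MCPR)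

/-- `LC`-mode utilization of the `LC` tasks. -/
def ULL : ℝ := ∑ i ∈ C.lcTasks, (C.task i).CL / (C.task i).T

/-- `LC`-mode utilization of the `HC` tasks. -/
def UHL : ℝ := ∑ i ∈ C.hcTasks, (C.task i).CL / (C.task i).T

/-- `HC`-mode utilization of the `HC` tasks. -/
def UHH : ℝ := ∑ i ∈ C.hcTasks, (C.task i).CH / (C.task i).T

/-- Largest increase of the utilization when `TL` of the `HC` tasks switch to `HC` mode. -/
def extraU : ℝ := C.topSum fun i => ((C.task i).CH - (C.task i).CL) / (C.task i).T

/-- Constant term of the linear upper bound on the demand. -/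
def demandConst : ℝ :=
  (∑ i ∈ C.lcTasks, (C.task i).CL)
    + ∑ i ∈ C.hcTasks, (C.task i).CH * (2 * (C.task i).T - (C.task i).D) / (C.task i).T

/-- Constant term of the linear lower bound
`(CL / T) * tE + (CH / T) * (t - tE) - supplyConst` on the supply. -/
def _root_.MixedCriticality.MCPR.supplyConst : ℝ :=
  I.CH / I.T * (2 * I.T - I.CH) - I.CL / I.T * I.CL

/-- Smallest spare capacity (resource rate minus demand rate) over the three extreme cases: both
mode switches at the start; internal switch at the start and external switch at the end; both at
the end. -/
def slack : ℝ :=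
  min (I.CH / I.T - C.UHH)
    (min (I.CL / I.T - (C.UHL + C.extraU)) (I.CL / I.T - (C.ULL + C.UHL)))

open Classical in
/-- The bound `t_MAX`, `⊤` if there is no spare capacity. -/
def tMax : WithTop ℝ :=
  if 0 < C.slack I then (((C.demandConst + I.supplyConst) / C.slack I : ℝ) : WithTop ℝ) else ⊤

end Component

/-! ### Run-time behaviour -/

/-- The data of a run of a component. Task `i` releases its `k`-th job at `release i k`, and that
job needs `demand i k` units of execution (possibly `0`, so that tasks with finitely many jobs are
covered). `switch i` is the instant at which the `HC` task `i` switches to `HC` mode (`⊤`: never),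
`extDrop` the earliest external mode switch of another component (`⊤`: none), `supply` the set of
instants at which the component is given the processor, and `exec s` the job that executes at
instant `s`. -/
structure Run (ι : Type*) where
  release : ι → ℕ → ℝ
  demand : ι → ℕ → ℝ
  switch : ι → WithTop ℝ
  extDrop : WithTop ℝ
  supply : Set ℝ
  exec : ℝ → Option (ι × ℕ)

namespace Run

variable {ι : Type*} [Fintype ι] (C : Component ι) (R : Run ι)

/-- Amount of resource supplied in `[a, b)`. -/
def supplied (a b : ℝ) : ℝ := volume.real (R.supply ∩ Ico a b)

/-- Execution received by the `k`-th job of task `i` before instant `s`. -/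
def executed (i : ι) (k : ℕ) (s : ℝ) : ℝ :=
  volume.real ({u | R.exec u = some (i, k)} ∩ Ico (R.release i k) s)

/-- The internal mode switch: the first switch of an `HC` task. -/
def ims : WithTop ℝ := C.hcTasks.inf R.switch

open Classical in
/-- At instant `s`, more than `TL` of the `HC` tasks have switched to `HC` mode. -/
def emsReached (s : ℝ) : Prop :=
  C.TL < (C.hcTasks.filter fun i => R.switch i ≤ (s : WithTop ℝ)).card

/-- The external mode switch occurs at `tE`. -/
def IsEMS (tE : ℝ) : Prop := IsLeast {s | R.emsReached C s} tE

/-- The instant at which the `LC` tasks are dropped. -/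
def dropTime : WithTop ℝ := min (R.ims C) R.extDrop

/-- Task `i` is in `HC` mode at instant `s`: it has switched, or the external mode switch has
occurred. -/
def inHC (i : ι) (s : ℝ) : Prop :=
  (C.task i).level = Level.HC ∧ (R.switch i ≤ (s : WithTop ℝ) ∨ R.emsReached C s)

open Classical in
/-- The absolute deadline by which the `k`-th job of task `i` is scheduled at instant `s`. -/
def currentDeadline (i : ι) (k : ℕ) (s : ℝ) : ℝ :=
  if R.inHC C i s then R.release i k + (C.task i).D else R.release i k + (C.task i).DL

/-- The `k`-th job of task `i` awaits execution at instant `s`. -/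
def Pending (i : ι) (k : ℕ) (s : ℝ) : Prop :=
  R.release i k ≤ s ∧ R.executed i k s < R.demand i k ∧
    ((C.task i).level = Level.LC → (s : WithTop ℝ) < R.dropTime C)

/-- `R` is a run of the component `C`, started at instant `0`, under preemptive
earliest-deadline-first scheduling (ties broken arbitrarily) within the supplied time. -/
structure IsRunOf : Prop where
  release_nonneg : ∀ i, 0 ≤ R.release i 0
  separation : ∀ i k, R.release i k + (C.task i).T ≤ R.release i (k + 1)
  demand_nonneg : ∀ i k, 0 ≤ R.demand i k
  demand_le : ∀ i k, R.demand i k ≤ (C.task i).CH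
  /-- An `HC` task switches to `HC` mode at the latest when one of its jobs has received `CL`
  and needs more. An interface task that stands for a child component may switch earlier, when
  its child does. -/
  switch_le : ∀ i, (C.task i).level = Level.HC → ∀ k s, (C.task i).CL < R.demand i k →
    (C.task i).CL ≤ R.executed i k s → R.switch i ≤ (s : WithTop ℝ)
  measurable_supply : MeasurableSet R.supply
  measurable_exec : ∀ i k, MeasurableSet {u | R.exec u = some (i, k)}
  exec_supply : ∀ s i k, R.exec s = some (i, k) → s ∈ R.supply
  exec_pending : ∀ s i k, R.exec s = some (i, k) → R.Pending C i k s
  exec_edf : ∀ s i k, R.exec s = some (i, k) → ∀ i' k', R.Pending C i' k' s →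
    R.currentDeadline C i k s ≤ R.currentDeadline C i' k' s
  work_conserving : ∀ s ∈ R.supply, (∃ i k, R.Pending C i k s) → R.exec s ≠ none

/-- The resource is supplied according to the interface `I`, whose mode switches at `tE`. In every
period (the phase of the periods is arbitrary) at least `CL` units are supplied. At least `CH`
units are supplied in each period that starts after `tE`, and also in the period that contains
`tE` if less than `CL` units of it have been supplied by then. -/
def SuppliedBy (I : MCPR) (tE : ℝ) : Prop :=
  ∃ φ : ℝ, ∀ k : ℤ,
    I.CL ≤ R.supplied (φ + k * I.T) (φ + (k + 1) * I.T) ∧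
    ((tE < φ + k * I.T ∨
        (φ + k * I.T ≤ tE ∧ tE < φ + (k + 1) * I.T ∧ R.supplied (φ + k * I.T) tE < I.CL)) →
      I.CH ≤ R.supplied (φ + k * I.T) (φ + (k + 1) * I.T))

/-- All deadlines that the execution model requires are met: those of `LC` jobs up to the instant
at which the `LC` tasks are dropped, those of all `HC` jobs, and, for `LC` WCETs, the tightened
deadlines of `HC` tasks up to their switch to `HC` mode. -/
structure MeetsDeadlines : Prop where
  lc : ∀ i k, (C.task i).level = Level.LC →
    ((R.release i k + (C.task i).D : ℝ) : WithTop ℝ) ≤ R.dropTime C →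
    R.demand i k ≤ R.executed i k (R.release i k + (C.task i).D)
  hc : ∀ i k, (C.task i).level = Level.HC →
    R.demand i k ≤ R.executed i k (R.release i k + (C.task i).D)
  hc_tightened : ∀ i k, (C.task i).level = Level.HC →
    (∀ s < R.release i k + (C.task i).DL, ¬ R.inHC C i s) →
    min (R.demand i k) (C.task i).CL ≤ R.executed i k (R.release i k + (C.task i).DL)

end Run

/-- The component `C` is schedulable in `HC` mode under the interface `I`: in every run of `C` in
which the external mode switch occurs and the resource is supplied according to `I` (whose mode is
the external mode of `C`), all required deadlines are met. -/
def SchedulableInHCMode {ι : Type*} [Fintype ι] (C : Component ι) (I : MCPR) : Prop :=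
  ∀ (R : Run ι) (tE : ℝ), R.IsRunOf C → R.IsEMS C tE → R.SuppliedBy I tE → R.MeetsDeadlines C

end MixedCriticality

end

/-! The proof is the processor-demand argument for EDF. Let `t` be the first instant at which a
required deadline is missed. Going back from it gives a window `[a, b)` in which all supply is used
by jobs released since `a` whose current deadline is at most `b` (`exists_busy_start`). The missing
job got less than it needs, so these jobs demand strictly more than the window supplies. It remains
to bound that demand by `dbf` and the supply by `sbf`; the contradiction is `no_deficit`.

Supply. Relative to a window, the interface guarantees one of four forms (`SupplyShape`), depending
on where the external switch falls. If it falls inside, the free parameter is the start `s` of the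
period containing it. Low-mode supply before `s` grows with slope 0 or 1 in `s`, and high-mode
supply after it decreases with slope at most 1, so only extreme alignments matter. These are
patterns A and B (`sbf_le_of_supplyShape`).

Demand. An `HC` task enters `HC` mode at some `e` between the drop instant and the external switch.
Its demand is not monotone in `e`, but it is at most `dbfA`, which increases with `e`, or at most
`dbfC`, which decreases. So the larger of the demand bounds at the two ends suffices
(`sum_le_max_dbf_HC`). That `t` is the first miss enters here: a job whose tightened deadline
precedes the switch has received the smaller of its demand and `CL` without causing a switch, hence
needs at most `CL`. Tasks that enter strictly before the external switch have switched by
themselves, so there are at most `TL` of them. They account for the `TL` largest differences, and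
all other `HC` tasks count with their bound at the external switch.

For windows longer than `tMax`, linear bounds on demand and supply replace the test. Their gap is
linear in the lengths `tI`, `tE - tI` and `t - tE`, with coefficients at least `slack`
(`dbf_le_supply`). -/

noncomputable section

namespace MixedCriticality

/-! ### The least supply of a periodic resource -/

/-- Least supply in `v` time units from the start of a period, when every period of length `T`
supplies at least `c` units. -/
def periodicSupply (T c v : ℝ) : ℝ :=
  (⌊v / T⌋ : ℝ) * c + max 0 (v - (⌊v / T⌋ : ℝ) * T - (T - c))

section periodicSupply

variable {T c : ℝ}

theorem periodicSupply_eq (hT : 0 < T) {v : ℝ} (k : ℤ) (h1 : k * T ≤ v) (h2 : v < k * T + T) :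
    periodicSupply T c v = k * c + max 0 (v - k * T - (T - c)) := by
  have : ⌊v / T⌋ = k := by
    rw [Int.floor_eq_iff, le_div_iff₀ hT, div_lt_iff₀ hT]
    constructor <;> linarith
  simp [periodicSupply, this]

theorem exists_period (hT : 0 < T) (v : ℝ) : ∃ k : ℤ, k * T ≤ v ∧ v < k * T + T := by
  refine ⟨⌊v / T⌋, ?_, ?_⟩
  · have := Int.floor_le (v / T)
    rwa [le_div_iff₀ hT] at this
  · have := Int.lt_floor_add_one (v / T)
    rw [div_lt_iff₀ hT] at this
    linarith

theorem periodicSupply_add_period (hT : 0 < T) (v : ℝ) :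
    periodicSupply T c (v + T) = periodicSupply T c v + c := by
  obtain ⟨k, h1, h2⟩ := exists_period hT v
  rw [periodicSupply_eq hT k h1 h2, periodicSupply_eq hT (k + 1) (by push_cast; linarith)
    (by push_cast; linarith)]
  push_cast
  ring_nf

theorem periodicSupply_mono_lipschitz (hT : 0 < T) (hc : 0 ≤ c) (hcT : c ≤ T) {x y : ℝ}
    (hxy : x ≤ y) :
    periodicSupply T c x ≤ periodicSupply T c y ∧
      periodicSupply T c y ≤ periodicSupply T c x + (y - x) := by
  obtain ⟨m, hm1, hm2⟩ := exists_period hT x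
  obtain ⟨n, hn1, hn2⟩ := exists_period hT y
  rw [periodicSupply_eq hT m hm1 hm2, periodicSupply_eq hT n hn1 hn2]
  have hmn : m ≤ n := by
    have : (m : ℝ) < n + 1 := by
      by_contra! h
      nlinarith
    have : m < n + 1 := by exact_mod_cast this
    omega
  rcases hmn.eq_or_lt with rfl | hlt
  · constructor
    · gcongr
    · rcases max_cases 0 (x - m * T - (T - c)) with h | h <;>
        rcases max_cases 0 (y - m * T - (T - c)) with h' | h' <;> linarith
  · have hlt' : (m : ℝ) + 1 ≤ n := by exact_mod_cast hlt
    have h1 : 0 ≤ ((n : ℝ) - m - 1) * c := mul_nonneg (by linarith) hc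
    have h2 : 0 ≤ ((n : ℝ) - m - 1) * (T - c) := mul_nonneg (by linarith) (by linarith)
    rcases max_cases 0 (x - m * T - (T - c)) with h | h <;>
        rcases max_cases 0 (y - n * T - (T - c)) with h' | h' <;> constructor <;> nlinarith

theorem periodicSupply_mono (hT : 0 < T) (hc : 0 ≤ c) (hcT : c ≤ T) {x y : ℝ} (hxy : x ≤ y) :
    periodicSupply T c x ≤ periodicSupply T c y :=
  (periodicSupply_mono_lipschitz hT hc hcT hxy).1

theorem periodicSupply_le_add (hT : 0 < T) (hc : 0 ≤ c) (hcT : c ≤ T) {x y : ℝ} (hxy : x ≤ y) :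
    periodicSupply T c y ≤ periodicSupply T c x + (y - x) :=
  (periodicSupply_mono_lipschitz hT hc hcT hxy).2

theorem periodicSupply_zero (hT : 0 < T) (hcT : c ≤ T) : periodicSupply T c 0 = 0 := by
  rw [periodicSupply_eq hT 0 (by simp) (by simpa using hT)]
  simp [hcT]

theorem periodicSupply_nonneg (hT : 0 < T) (hc : 0 ≤ c) (hcT : c ≤ T) {v : ℝ} (hv : 0 ≤ v) :
    0 ≤ periodicSupply T c v := by
  rw [← periodicSupply_zero (c := c) hT hcT]
  exact periodicSupply_mono hT hc hcT hv

theorem periodicSupply_nonpos (hT : 0 < T) (hc : 0 ≤ c) (hcT : c ≤ T) {v : ℝ} (hv : v ≤ 0) :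
    periodicSupply T c v ≤ 0 := by
  rw [← periodicSupply_zero (c := c) hT hcT]
  exact periodicSupply_mono hT hc hcT hv

/-- The line touches the graph at the corners `k * T + (T - c)`, where the rise within a period
begins. -/
theorem linear_le_periodicSupply (hT : 0 < T) (hc : 0 ≤ c) (hcT : c ≤ T) (v : ℝ) :
    c / T * (v - (T - c)) ≤ periodicSupply T c v := by
  obtain ⟨k, h1, h2⟩ := exists_period hT v
  rw [periodicSupply_eq hT k h1 h2]
  have hq : c / T ≤ 1 := (div_le_one hT).2 hcT
  have hq0 : 0 ≤ c / T := div_nonneg hc hT.le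
  have e : c / T * (v - (T - c)) = k * c + c / T * (v - k * T - (T - c)) := by
    field_simp
    ring
  rw [e]
  rcases max_cases 0 (v - k * T - (T - c)) with h | h <;> nlinarith

/-- On the segment that starts with the rise towards a period boundary. -/
theorem periodicSupply_eq_min (hT : 0 < T) (hc : 0 ≤ c) (hcT : c ≤ T) {s : ℝ} (j : ℤ)
    (h1 : j * T - c ≤ s) (h2 : s < j * T - c + T) :
    periodicSupply T c s = (j - 1) * c + min c (s - (j * T - c)) := by
  rcases lt_or_ge s (j * T) with h | h
  · rw [periodicSupply_eq hT (j - 1) (by push_cast; linarith) (by push_cast; linarith)]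
    push_cast
    rw [max_eq_right (by linarith), min_eq_right (by linarith)]
    ring
  · rw [periodicSupply_eq hT j h (by linarith), max_eq_left (by linarith), min_eq_left (by linarith)]
    ring

end periodicSupply

/-! ### Supply guaranteed in a window of a run -/

namespace Run

variable {ι : Type*} (R : Run ι)

theorem supplied_nonneg (a b : ℝ) : 0 ≤ R.supplied a b := measureReal_nonneg

theorem volume_inter_Ico_ne_top (A : Set ℝ) (a b : ℝ) : volume (A ∩ Ico a b) ≠ ⊤ :=
  ((measure_mono inter_subset_right).trans_lt measure_Ico_lt_top).ne

theorem supplied_le (a b : ℝ) (h : a ≤ b) : R.supplied a b ≤ b - a := by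
  have : volume.real (Ico a b) = b - a := by simp [h]
  rw [← this]
  exact measureReal_mono inter_subset_right measure_Ico_lt_top.ne

theorem volumeReal_inter_Ico_add {A : Set ℝ} {a b c : ℝ} (hab : a ≤ b)
    (hbc : b ≤ c) :
    volume.real (A ∩ Ico a b) + volume.real (A ∩ Ico b c) = volume.real (A ∩ Ico a c) := by
  have h := measureReal_inter_add_sdiff (μ := volume) (s := A ∩ Ico a c) (t := Ico a b)
    measurableSet_Ico (volume_inter_Ico_ne_top A a c)
  rw [← h]
  congr 2
  · ext x; simp only [mem_inter_iff, mem_Ico]; constructor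
    · rintro ⟨h1, h2, h3⟩; exact ⟨⟨h1, h2, by linarith⟩, h2, h3⟩
    · rintro ⟨⟨h1, h2, h3⟩, h4, h5⟩; exact ⟨h1, h4, h5⟩
  · ext x; simp only [mem_inter_iff, mem_Ico, mem_sdiff, not_and, not_lt]; constructor
    · rintro ⟨h1, h2, h3⟩; exact ⟨⟨h1, by linarith, h3⟩, fun _ => h2⟩
    · rintro ⟨⟨h1, h2, h3⟩, h4⟩; exact ⟨h1, h4 h2, h3⟩

theorem supplied_add {a b c : ℝ} (hab : a ≤ b) (hbc : b ≤ c) :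
    R.supplied a b + R.supplied b c = R.supplied a c :=
  volumeReal_inter_Ico_add hab hbc

theorem supplied_mono {a b c d : ℝ} (hab : a ≤ b) (hcd : c ≤ d) :
    R.supplied b c ≤ R.supplied a d :=
  measureReal_mono (inter_subset_inter_right _ (Ico_subset_Ico hab hcd))
    (volume_inter_Ico_ne_top _ _ _)

/-- Complete periods contribute `c` each. The last, incomplete one contributes at least `c` minus
the length of its part beyond `b`. -/
theorem periodicSupply_le_supplied_from {T c : ℝ} (hT : 0 < T) (hc : 0 ≤ c) (hcT : c ≤ T) {s : ℝ}
    (h : ∀ n : ℕ, c ≤ R.supplied (s + n * T) (s + (n + 1) * T)) (b : ℝ) :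
    periodicSupply T c (b - s) ≤ R.supplied s b := by
  rcases le_or_gt b s with hb | hb
  · exact (periodicSupply_nonpos hT hc hcT (by linarith)).trans (R.supplied_nonneg _ _)
  have hfull : ∀ n : ℕ, n * c ≤ R.supplied s (s + n * T) := by
    intro n
    induction n with
    | zero => simpa using R.supplied_nonneg _ _
    | succ n ih =>
      have h1 := R.supplied_add (a := s) (b := s + n * T) (c := s + (n + 1) * T)
        (by nlinarith [(Nat.cast_nonneg n : (0 : ℝ) ≤ n)]) (by linarith)
      have := h n
      push_cast
      linarith
  obtain ⟨k, h1, h2⟩ := exists_period hT (b - s)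
  have hk : 0 ≤ k := by
    have : (-1 : ℝ) < k := by nlinarith
    have : (-1 : ℤ) < k := by exact_mod_cast this
    omega
  obtain ⟨n, rfl⟩ := Int.eq_ofNat_of_zero_le hk
  rw [periodicSupply_eq hT _ h1 h2]
  simp only [Int.cast_natCast] at *
  have e1 := R.supplied_add (a := s) (b := s + n * T) (c := b)
    (by nlinarith [(Nat.cast_nonneg n : (0 : ℝ) ≤ n)]) (by linarith)
  have e2 := R.supplied_add (a := s + n * T) (b := b) (c := s + (n + 1) * T) (by linarith)
    (by linarith)
  have e3 := R.supplied_le b (s + (n + 1) * T) (by linarith)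
  have e4 := h n
  have e5 := hfull n
  have e6 := R.supplied_nonneg (s + n * T) b
  have : max 0 (b - s - n * T - (T - c)) ≤ R.supplied (s + n * T) b := max_le e6 (by linarith)
  linarith

/-- Mirror image in time: the incomplete period is now the earliest one. -/
theorem periodicSupply_le_supplied_to {T c : ℝ} (hT : 0 < T) (hc : 0 ≤ c) (hcT : c ≤ T) {s : ℝ}
    (h : ∀ n : ℕ, c ≤ R.supplied (s - (n + 1) * T) (s - n * T)) (a : ℝ) :
    periodicSupply T c (s - a) ≤ R.supplied a s := by
  rcases le_or_gt s a with hb | hb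
  · exact (periodicSupply_nonpos hT hc hcT (by linarith)).trans (R.supplied_nonneg _ _)
  have hfull : ∀ n : ℕ, n * c ≤ R.supplied (s - n * T) s := by
    intro n
    induction n with
    | zero => simpa using R.supplied_nonneg _ _
    | succ n ih =>
      have h1 := R.supplied_add (a := s - (n + 1) * T) (b := s - n * T) (c := s)
        (by linarith) (by nlinarith [(Nat.cast_nonneg n : (0 : ℝ) ≤ n)])
      have := h n
      push_cast
      linarith
  obtain ⟨k, h1, h2⟩ := exists_period hT (s - a)
  have hk : 0 ≤ k := by
    have : (-1 : ℝ) < k := by nlinarith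
    have : (-1 : ℤ) < k := by exact_mod_cast this
    omega
  obtain ⟨n, rfl⟩ := Int.eq_ofNat_of_zero_le hk
  rw [periodicSupply_eq hT _ h1 h2]
  simp only [Int.cast_natCast] at *
  have e1 := R.supplied_add (a := a) (b := s - n * T) (c := s) (by linarith)
    (by nlinarith [(Nat.cast_nonneg n : (0 : ℝ) ≤ n)])
  have e2 := R.supplied_add (a := s - (n + 1) * T) (b := a) (c := s - n * T) (by linarith)
    (by linarith)
  have e3 := R.supplied_le (s - (n + 1) * T) a (by linarith)
  have e4 := h n
  have e5 := hfull n
  have e6 := R.supplied_nonneg a (s - n * T)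
  have : max 0 (s - a - n * T - (T - c)) ≤ R.supplied a (s - n * T) := max_le e6 (by linarith)
  linarith

end Run

namespace Run

variable {ι : Type*} (R : Run ι)

/-- Supply in a window whose first full period starts late, if all relevant periods supply at
least `c` units. -/
theorem periodicSupply_le_supplied_window {T c d : ℝ} (hT : 0 < T) (hc : 0 ≤ c) (hcT : c ≤ T)
    (hdc : d ≤ c) {s a b : ℝ} (hab : a ≤ b) (hsa : s ≤ a) (hsT : a < s + T)
    (h : ∀ n : ℕ, c ≤ R.supplied (s + T + n * T) (s + T + (n + 1) * T))
    (h0 : a - s < d → c ≤ R.supplied s (s + T)) :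
    periodicSupply T c (b - a - (T - d)) ≤ R.supplied a b := by
  rcases lt_or_ge (a - s) d with hd | hd
  · have h' : ∀ n : ℕ, c ≤ R.supplied (s + n * T) (s + (n + 1) * T) := by
      intro n
      cases n with
      | zero => simpa using h0 hd
      | succ n =>
        have := h n
        push_cast
        convert this using 2 <;> ring
    have e1 := R.periodicSupply_le_supplied_from hT hc hcT h' b
    have e2 := R.supplied_add hsa hab
    have e3 := R.supplied_le s a hsa
    have e4 := periodicSupply_le_add hT hc hcT (x := b - s - T) (y := b - a - (T - d))
      (by linarith)
    have e5 := periodicSupply_add_period (c := c) hT (b - s - T)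
    rw [sub_add_cancel] at e5
    linarith
  · have e1 := R.periodicSupply_le_supplied_from hT hc hcT h b
    have e2 := R.supplied_mono (a := a) (b := s + T) (c := b) (d := b) hsT.le le_rfl
    have e5 := periodicSupply_mono hT hc hcT (x := b - a - (T - d)) (y := b - (s + T))
      (by linarith)
    linarith

/-- The shapes of the least supply in a window of length `t`, with the mode switch at `tE`
relative to its start. -/
def SupplyShape (I : MCPR) (tE t S : ℝ) : Prop :=
  (tE = t ∧ periodicSupply I.T I.CL (t - (I.T - I.CL)) ≤ S) ∨
  (tE = 0 ∧ periodicSupply I.T I.CH (t - (I.T - I.CL)) ≤ S) ∨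
  (tE < t ∧ ∃ s, tE - I.T < s ∧ s ≤ tE ∧
    periodicSupply I.T I.CL s + periodicSupply I.T I.CH (t - s) ≤ S) ∨
  (tE < t ∧ ∃ s, tE - I.T < s ∧ s ≤ tE - I.CL ∧
    periodicSupply I.T I.CL s + I.CL + max 0 (periodicSupply I.T I.CH (t - s - I.T)) ≤ S)

/-- The switch comes after, before or inside the window. If inside, its period owes `CH` or only
`CL` according to whether `CL` units have been supplied by then; this separates the last two forms.
-/
theorem supplyShape_of_suppliedBy {I : MCPR} {tE a b : ℝ} (h : R.SuppliedBy I tE) (hab : a < b) :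
    SupplyShape I (max 0 (min (tE - a) (b - a))) (b - a) (R.supplied a b) := by
  obtain ⟨φ, hφ⟩ := h
  have hT := I.T_pos
  have hCL := I.CL_nonneg
  have hCLH := I.CL_le_CH
  have hCH := I.CH_le_T
  have hCLT : I.CL ≤ I.T := hCLH.trans hCH
  have hCH0 : 0 ≤ I.CH := hCL.trans hCLH
  have full : ∀ (k : ℤ) (n : ℕ), I.CL ≤ R.supplied (φ + k * I.T + n * I.T)
      (φ + k * I.T + (n + 1) * I.T) := by
    intro k n
    have := (hφ (k + n)).1
    push_cast at this
    convert this using 2 <;> ring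
  have back : ∀ (k : ℤ) (n : ℕ), I.CL ≤ R.supplied (φ + k * I.T - (n + 1) * I.T)
      (φ + k * I.T - n * I.T) := by
    intro k n
    have := (hφ (k - n - 1)).1
    push_cast at this
    convert this using 2 <;> ring
  have high : ∀ k : ℤ, tE < φ + k * I.T + I.T → ∀ n : ℕ,
      I.CH ≤ R.supplied (φ + k * I.T + I.T + n * I.T) (φ + k * I.T + I.T + (n + 1) * I.T) := by
    intro k hk n
    have := (hφ (k + 1 + n)).2 (Or.inl (by
      push_cast; nlinarith [(Nat.cast_nonneg n : (0 : ℝ) ≤ n)]))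
    push_cast at this
    convert this using 2 <;> ring
  rcases le_or_gt b tE with hb | hb
  · left
    rw [min_eq_right (by linarith), max_eq_right (by linarith)]
    refine ⟨rfl, ?_⟩
    obtain ⟨k, h1, h2⟩ := exists_period hT (a - φ)
    refine R.periodicSupply_le_supplied_window hT hCL hCLT le_rfl hab.le
      (s := φ + k * I.T) (by linarith) (by linarith) (fun n => ?_) (fun _ => ?_)
    · have := full (k + 1) n
      push_cast at this
      convert this using 2 <;> ring
    · simpa using full k 0
  rcases lt_or_ge tE a with ha | ha
  · right; left
    rw [min_eq_left (by linarith), max_eq_left (by linarith)]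
    refine ⟨rfl, ?_⟩
    obtain ⟨k, h1, h2⟩ := exists_period hT (a - φ)
    refine R.periodicSupply_le_supplied_window hT hCH0 hCH hCLH hab.le
      (s := φ + k * I.T) (by linarith) (by linarith) (high k (by linarith)) (fun hd => ?_)
    have := (hφ k).2
    rw [show φ + (k + 1) * I.T = φ + k * I.T + I.T by ring] at this
    refine this ?_
    rcases lt_or_ge tE (φ + k * I.T) with hlt | hge
    · exact Or.inl hlt
    -- Since `tE - s < a - s < CL`, fewer than `CL` units can precede the switch in this period.
    · refine Or.inr ⟨hge, by linarith, ?_⟩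
      have := R.supplied_le _ _ hge
      linarith
  · right; right
    rw [min_eq_left (by linarith), max_eq_right (by linarith)]
    obtain ⟨k, h1, h2⟩ := exists_period hT (tE - φ)
    set s := φ + k * I.T with hs
    have hsE : s ≤ tE := by linarith
    have hsT : tE < s + I.T := by linarith
    have hk := hφ k
    rw [show φ + (k + 1) * I.T = s + I.T by rw [hs]; ring, ← hs] at hk
    rcases lt_or_ge (R.supplied s tE) I.CL with hlt | hge
    · left
      refine ⟨by linarith, s - a, by linarith, by linarith, ?_⟩
      have h' : ∀ n : ℕ, I.CH ≤ R.supplied (s + n * I.T) (s + (n + 1) * I.T) := by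
        intro n
        cases n with
        | zero => simpa using hk.2 (Or.inr ⟨hsE, hsT, hlt⟩)
        | succ n =>
          have := high k (by linarith) n
          push_cast
          convert this using 2 <;> ring
      have e1 := R.periodicSupply_le_supplied_from hT hCH0 hCH h' b
      rw [show b - a - (s - a) = b - s by ring]
      rcases le_or_gt a s with has | has
      · have e2 := R.periodicSupply_le_supplied_to hT hCL hCLT (back k) a
        have e3 := R.supplied_add has (hsE.trans hb.le)
        rw [← hs] at e2
        linarith
      · have e2 := R.supplied_add has.le hab.le
        have e3 := R.supplied_le s a has.le
        have e4 := R.supplied_mono (a := s) (b := s) (c := a) (d := tE) le_rfl ha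
        -- For a period that begins before the window, the negative argument yields `-min CL (a -
        -- s)`, which accounts for what the period may have supplied before `a`.
        have e5 : periodicSupply I.T I.CL (s - a) = -I.CL + max 0 (s - a + I.CL) := by
          rw [periodicSupply_eq hT (-1) (by push_cast; linarith) (by push_cast; linarith)]
          push_cast
          ring_nf
        rw [e5]
        rcases max_cases 0 (s - a + I.CL) with h | h <;> linarith
    · right
      have hle := R.supplied_le s tE hsE
      refine ⟨by linarith, s - a, by linarith, by linarith, ?_⟩
      have e1 := R.periodicSupply_le_supplied_from hT hCH0 hCH (high k (by linarith)) b
      rw [show b - a - (s - a) - I.T = b - (s + I.T) by ring]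
      have e6 : max 0 (periodicSupply I.T I.CH (b - (s + I.T))) ≤ R.supplied tE b -
          (if s + I.T ≤ b then R.supplied tE (s + I.T) else 0) := by
        split_ifs with hif
        · have := R.supplied_add hsT.le hif
          refine max_le ?_ ?_
          · have := R.supplied_nonneg (s + I.T) b
            linarith
          · linarith
        · have := periodicSupply_nonpos hT hCH0 hCH (v := b - (s + I.T)) (by linarith)
          have := R.supplied_nonneg tE b
          exact max_le (by linarith) (by linarith)
      have e7 : 0 ≤ (if s + I.T ≤ b then R.supplied tE (s + I.T) else 0) := by
        split_ifs
        · exact R.supplied_nonneg _ _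
        · exact le_rfl
      have e8 := R.supplied_add ha hb.le
      rcases le_or_gt a s with has | has
      · have e2 := R.periodicSupply_le_supplied_to hT hCL hCLT (back k) a
        have e3 := R.supplied_add has hsE
        rw [← hs] at e2
        linarith
      · have e2 := R.supplied_add has.le ha
        have e3 := R.supplied_le s a has.le
        have e5 : periodicSupply I.T I.CL (s - a) = -I.CL + max 0 (s - a + I.CL) := by
          rw [periodicSupply_eq hT (-1) (by push_cast; linarith) (by push_cast; linarith)]
          push_cast
          ring_nf
        have e9 := R.supplied_nonneg a tE
        rw [e5]
        rcases max_cases 0 (s - a + I.CL) with h | h <;> linarith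

end Run

/-! ### Comparison of the guaranteed supply with the linear bound and with `sbf` -/

namespace MCPR

variable (I : MCPR)

theorem CL_le_T : I.CL ≤ I.T := I.CL_le_CH.trans I.CH_le_T

theorem CH_nonneg : 0 ≤ I.CH := I.CL_nonneg.trans I.CL_le_CH

/-- Each periodic term is replaced by its linear minorant. Since `CL / T ≤ CH / T`, moving the
change of rate from `s` to the later instant `tE` only lowers the value. -/
theorem supplyShape_linear {tE t S : ℝ} (h0 : 0 ≤ tE) (h1 : tE ≤ t)
    (h : Run.SupplyShape I tE t S) :
    I.CL / I.T * tE + I.CH / I.T * (t - tE) - I.supplyConst ≤ S := by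
  have hT := I.T_pos
  have hCL := I.CL_nonneg
  have hCLH := I.CL_le_CH
  have hCH := I.CH_le_T
  have hCLT := I.CL_le_T
  have hCH0 := I.CH_nonneg
  have linL := fun v => linear_le_periodicSupply hT hCL hCLT v
  have linH := fun v => linear_le_periodicSupply hT hCH0 hCH v
  unfold supplyConst
  set p := I.CL / I.T with hp
  set q := I.CH / I.T with hq
  have ep : I.CL = p * I.T := by rw [hp]; field_simp
  have eq' : I.CH = q * I.T := by rw [hq]; field_simp
  have hp0 : 0 ≤ p := div_nonneg hCL hT.le
  have hpq : p ≤ q := div_le_div_of_nonneg_right hCLH hT.le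
  have hq1 : q ≤ 1 := (div_le_one hT).2 hCH
  rcases h with ⟨rfl, h⟩ | ⟨rfl, h⟩ | ⟨_, s, hs1, hs2, h⟩ | ⟨_, s, hs1, hs2, h⟩
  · have := linL (tE - (I.T - I.CL))
    rw [ep] at this h ⊢
    rw [eq']
    have : 0 ≤ (q - p) * (2 - q - p) * I.T :=
      mul_nonneg (mul_nonneg (by linarith) (by linarith)) hT.le
    nlinarith
  · have := linH (t - (I.T - I.CL))
    rw [eq', ep] at this h ⊢
    have : 0 ≤ p * (q - p) * I.T := mul_nonneg (mul_nonneg hp0 (by linarith)) hT.le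
    nlinarith
  · have e1 := linL s
    have e2 := linH (t - s)
    have e3 : 0 ≤ (q - p) * (tE - s) := mul_nonneg (by linarith) (by linarith)
    rw [eq', ep] at h
    rw [ep] at e1
    rw [eq'] at e2
    rw [eq', ep]
    have : 0 ≤ (q - p) * I.T := mul_nonneg (by linarith) hT.le
    nlinarith
  · have e1 := linL s
    have e2 := linH (t - s - I.T)
    have e3 : 0 ≤ (q - p) * (tE - p * I.T - s) := mul_nonneg (by linarith) (by linarith)
    have e4 := le_max_right 0 (periodicSupply I.T I.CH (t - s - I.T))
    rw [eq', ep] at h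
    rw [eq'] at e4
    rw [ep] at e1
    rw [eq'] at e2
    rw [eq', ep]
    nlinarith

end MCPR

namespace MCPR
variable (I : MCPR)

theorem periodicSupply_add_int_mul {T c : ℝ} (hT : 0 < T) (v : ℝ) (k : ℤ) :
    periodicSupply T c (v + k * T) = periodicSupply T c v + k * c := by
  obtain ⟨m, h1, h2⟩ := exists_period hT v
  rw [periodicSupply_eq hT m h1 h2, periodicSupply_eq hT (m + k) (by push_cast; linarith)
    (by push_cast; linarith)]
  push_cast
  ring_nf

/-- The supply after the first full period of a pattern in which all periods supply `CH`. -/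
theorem floor_mul_add_max {x : ℝ} (hx : 0 ≤ x) :
    ((max 0 ⌊x / I.T⌋ : ℤ) : ℝ) * I.CH
      + max 0 (x - (I.T - I.CH) - ((max 0 ⌊x / I.T⌋ : ℤ) : ℝ) * I.T) =
        periodicSupply I.T I.CH x := by
  rw [max_eq_right (Int.floor_nonneg.2 (div_nonneg hx I.T_pos.le)), periodicSupply]
  congr 2
  ring

theorem max_zero_floor_of_neg {x : ℝ} (hx : x < 0) : max 0 ⌊x / I.T⌋ = 0 :=
  max_eq_left (Int.floor_lt.2 (by simpa using div_neg_of_neg_of_pos hx I.T_pos)).le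

theorem sbfLC_le (t : ℝ) :
    I.sbfLC t ≤ max 0 (periodicSupply I.T I.CL (t - (I.T - I.CL))) := by
  have := I.CL_le_T
  unfold sbfLC
  rcases lt_or_ge (t - (I.T - I.CL)) 0 with h | h
  · simp only [I.max_zero_floor_of_neg h]
    refine le_max_of_le_left ?_
    simp only [Int.cast_zero, zero_mul, zero_add, sub_zero, max_le_iff, le_refl, true_and]
    linarith
  · refine le_max_of_le_right ?_
    rw [max_eq_right (Int.floor_nonneg.2 (div_nonneg h I.T_pos.le)), periodicSupply]
    apply le_of_eq
    ring_nf

/-- Pattern A when the switch precedes the first full period. -/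
theorem sbfA_le_of_lt {tE t : ℝ} (hE : tE < I.T - I.CL) :
    I.sbfA tE t ≤ max 0 (periodicSupply I.T I.CH (t - (I.T - I.CL))) := by
  have h0 := I.CL_nonneg
  have h1 := I.CH_le_T
  unfold sbfA
  simp only [I.max_zero_floor_of_neg (x := tE - (I.T - I.CL)) (by linarith)]
  rw [if_pos (by push_cast; linarith)]
  rcases lt_or_ge (t - (I.T - I.CL)) 0 with h | h
  · refine le_max_of_le_left ?_
    rw [I.max_zero_floor_of_neg h, max_eq_left (by push_cast; linarith)]
    simp
  · refine le_max_of_le_right ?_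
    rw [← I.floor_mul_add_max h]
    apply le_of_eq
    push_cast
    ring_nf

/-- Pattern A when the switch lies in the `n`-th full period. -/
theorem sbfA_le {tE t : ℝ} (h : tE ≤ t) (n : ℕ) (h1 : n * I.T + I.T - I.CL ≤ tE)
    (h2 : tE < n * I.T + I.T - I.CL + I.T) :
    I.sbfA tE t ≤ n * I.CL + periodicSupply I.T I.CH (t - (n * I.T + I.T - I.CL)) ∧
    (I.CL ≤ tE - (n * I.T + I.T - I.CL) → I.sbfA tE t ≤ (n + 1) * I.CL +
      max 0 (periodicSupply I.T I.CH (t - (n * I.T + I.T - I.CL) - I.T))) := by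
  have hT := I.T_pos
  have hCLH := I.CL_le_CH
  have hfl : ⌊(tE - (I.T - I.CL)) / I.T⌋ = n := by
    rw [Int.floor_eq_iff, le_div_iff₀ hT, div_lt_iff₀ hT]
    push_cast
    constructor <;> linarith
  have hn0 : (0 : ℝ) ≤ n := Nat.cast_nonneg n
  have hx : 0 ≤ t - (I.T - I.CL) := by nlinarith
  have hsum := I.floor_mul_add_max hx
  unfold sbfA
  simp only [hfl, show max (0 : ℤ) n = n by simp, Int.cast_natCast]
  have e0 := periodicSupply_add_int_mul (c := I.CH) hT (t - (n * I.T + I.T - I.CL)) n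
  rw [show t - (n * I.T + I.T - I.CL) + ((n : ℤ) : ℝ) * I.T = t - (I.T - I.CL) by
    push_cast; ring] at e0
  have e1 := periodicSupply_add_period (c := I.CH) hT (t - (n * I.T + I.T - I.CL) - I.T)
  rw [sub_add_cancel] at e1
  push_cast at e0
  set N : ℝ := ((max 0 ⌊(t - (I.T - I.CL)) / I.T⌋ : ℤ) : ℝ) with hN
  have hlast : t - (2 * I.T - I.CL - I.CH) - N * I.T =
    t - (I.T - I.CL) - (I.T - I.CH) - N * I.T := by ring
  rw [hlast]
  set last := max 0 (t - (I.T - I.CL) - (I.T - I.CH) - N * I.T)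
  split_ifs with c1 c2
  · refine ⟨by linarith, fun h => absurd h (by linarith)⟩
  · refine ⟨by linarith, fun _ => ?_⟩
    have := le_max_right 0 (periodicSupply I.T I.CH (t - (n * I.T + I.T - I.CL) - I.T))
    linarith
  · have hNn : N = n := by
      have : N * I.T = n * I.T := by push Not at c2; linarith
      exact mul_right_cancel₀ hT.ne' this
    have := min_le_left I.CL last
    have := min_le_right I.CL last
    have := le_max_left 0 (periodicSupply I.T I.CH (t - (n * I.T + I.T - I.CL) - I.T))
    rw [hNn] at hsum
    exact ⟨by linarith, fun _ => by linarith⟩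

/-- Here `tE - s1 = (⌈tE / T⌉ - 1) * T + CL`, so `nE = ⌈tE / T⌉ - 1` because `CL < T`. -/
theorem sbfB_le {tE t : ℝ} (h0 : 0 ≤ tE) (h : tE ≤ t) (hCL : I.CL < I.T) :
    I.sbfB tE t ≤ (⌈tE / I.T⌉ : ℝ) * I.CL +
      max 0 (periodicSupply I.T I.CH (t - tE + I.CL - I.T)) := by
  have hT := I.T_pos
  have hCL0 := I.CL_nonneg
  set K := ⌈tE / I.T⌉ with hK
  have hK1 : tE ≤ K * I.T := by
    have := Int.le_ceil (tE / I.T)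
    rwa [div_le_iff₀ hT] at this
  have hK2 : K * I.T < tE + I.T := by
    have := Int.ceil_lt_add_one (tE / I.T)
    rw [← sub_lt_iff_lt_add, lt_div_iff₀ hT] at this
    linarith
  obtain ⟨s1, hs1⟩ : ∃ s1, s1 = I.T - I.CL - (K * I.T - tE) := ⟨_, rfl⟩
  obtain ⟨n, hn⟩ : ∃ n : ℝ, n = ((max 0 ⌊(t - s1) / I.T⌋ : ℤ) : ℝ) := ⟨_, rfl⟩
  have hfl : ⌊(tE - s1) / I.T⌋ = K - 1 := by
    rw [Int.floor_eq_iff, le_div_iff₀ hT, div_lt_iff₀ hT]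
    push_cast
    constructor <;> linarith
  have hfl' : ((⌊(tE - s1) / I.T⌋ : ℤ) : ℝ) = K - 1 := by rw [hfl]; push_cast; rfl
  have hdef : I.sbfB tE t =
      if n * I.T + I.T + s1 ≠ tE - I.CL + I.T then
        ((K : ℝ) - 1 + 1) * I.CL + (n - ((K : ℝ) - 1) - 1) * I.CH
          + max 0 (t - s1 - (I.T - I.CH) - n * I.T)
      else ((K : ℝ) - 1) * I.CL + min I.CL (max 0 (t - s1 - (I.T - I.CH) - n * I.T)) := by
    rw [← hfl', hn, hs1]
    rfl
  rw [hdef]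
  -- `t < s1` is possible only for `tE = 0`, because `s1 ≤ tE` as soon as `⌈tE / T⌉ ≥ 1`.
  rcases lt_or_ge (t - s1) 0 with hx | hx
  · have hK0 : K = 0 := by
      have hK0 : 0 ≤ K := Int.ceil_nonneg (div_nonneg h0 hT.le)
      have : (K : ℝ) < 1 := by nlinarith
      have : K < 1 := by exact_mod_cast this
      omega
    have hn0 : n = 0 := by rw [hn, I.max_zero_floor_of_neg hx]; simp
    have hCH := I.CH_le_T
    rw [hn0, hK0]
    rw [hK0] at hs1
    push_cast at *
    rw [if_pos (by linarith), max_eq_left (by linarith)]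
    simp
  · have hsum := I.floor_mul_add_max hx
    rw [← hn] at hsum
    have e0 := periodicSupply_add_int_mul (c := I.CH) hT (t - tE + I.CL - I.T) K
    rw [show t - tE + I.CL - I.T + K * I.T = t - s1 by rw [hs1]; ring] at e0
    split_ifs with c
    · have := le_max_right 0 (periodicSupply I.T I.CH (t - tE + I.CL - I.T))
      linarith
    · have := min_le_left I.CL (max 0 (t - s1 - (I.T - I.CH) - n * I.T))
      have := le_max_left 0 (periodicSupply I.T I.CH (t - tE + I.CL - I.T))
      linarith

theorem sbfA_le_or_exists_period (tE t : ℝ) :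
    tE < I.T - I.CL ∧ I.sbfA tE t ≤ max 0 (periodicSupply I.T I.CH (t - (I.T - I.CL))) ∨
    ∃ n : ℕ, n * I.T + I.T - I.CL ≤ tE ∧ tE < n * I.T + I.T - I.CL + I.T := by
  rcases lt_or_ge tE (I.T - I.CL) with hE | hE
  · exact Or.inl ⟨hE, I.sbfA_le_of_lt hE⟩
  · right
    obtain ⟨k, h1, h2⟩ := exists_period I.T_pos (tE - (I.T - I.CL))
    have hk : 0 ≤ k := by
      have : (-1 : ℝ) < k := by nlinarith [I.T_pos]
      have : (-1 : ℤ) < k := by exact_mod_cast this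
      omega
    obtain ⟨n, rfl⟩ := Int.eq_ofNat_of_zero_le hk
    push_cast at *
    exact ⟨n, by linarith, by linarith⟩

/-- Where the `CL` term rises in `s` with slope 1, it outweighs the loss in the `CH` term, and the
left end of the rise is worst. Where the `CL` term is flat, later `s` is worse. The rises start at
`j * T - CL`, which is the alignment of pattern A. Pattern B is needed only when the constraint `s ≤
tE - CL` of the fourth form cuts a flat stretch short. -/
theorem sbf_le_of_supplyShape {tE t S : ℝ} (h0 : 0 ≤ tE) (h1 : tE ≤ t) (hS : 0 ≤ S)
    (h : Run.SupplyShape I tE t S) : I.sbf tE t ≤ S := by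
  have hT := I.T_pos
  have hCL := I.CL_nonneg
  have hCLH := I.CL_le_CH
  have hCH := I.CH_le_T
  have hCLT := I.CL_le_T
  have hCH0 := I.CH_nonneg
  have mono := fun {x y : ℝ} (hxy : x ≤ y) => periodicSupply_mono hT hCH0 hCH hxy
  have lip := fun {x y : ℝ} (hxy : x ≤ y) => periodicSupply_le_add hT hCH0 hCH hxy
  have add := fun x : ℝ => periodicSupply_add_period (c := I.CH) hT x
  unfold sbf
  split_ifs with heq
  · subst heq
    refine (I.sbfLC_le tE).trans (max_le hS ?_)
    rcases h with ⟨_, h⟩ | ⟨rfl, h⟩ | ⟨h, _⟩ | ⟨h, _⟩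
    · exact h
    · exact (periodicSupply_nonpos hT hCL hCLT (by linarith)).trans hS
    · exact absurd h (lt_irrefl _)
    · exact absurd h (lt_irrefl _)
  rcases h with ⟨h, _⟩ | ⟨rfl, h⟩ | ⟨_, s, hs1, hs2, h⟩ | ⟨_, s, hs1, hs2, h⟩
  · exact absurd h heq
  · refine (min_le_left _ _).trans ?_
    rcases I.sbfA_le_or_exists_period 0 t with ⟨_, hA⟩ | ⟨n, hn1, hn2⟩
    · exact hA.trans (max_le hS h)
    -- This occurs only for `CL = T`.
    · have hn : n = 0 := by
        by_contra hn
        have : (1 : ℝ) ≤ n := by exact_mod_cast Nat.one_le_iff_ne_zero.2 hn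
        nlinarith
      subst hn
      have := (I.sbfA_le h1 0 hn1 hn2).1
      push_cast at this
      rw [zero_mul, zero_mul, zero_add, zero_add] at this
      linarith
  · refine (min_le_left _ _).trans ?_
    -- `s` lies in the segment from `j * T - CL` to `(j + 1) * T - CL`: a rise of length `CL`, then
    -- a flat stretch.
    obtain ⟨j, hj1, hj2⟩ := exists_period hT (s + I.CL)
    rw [periodicSupply_eq_min hT hCL hCLT j (by linarith) (by linarith)] at h
    have hts : 0 ≤ periodicSupply I.T I.CH (t - s) :=
      periodicSupply_nonneg hT hCH0 hCH (by linarith)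
    have a0 := add (t - (j * I.T - I.CL) - I.T)
    rw [sub_add_cancel] at a0
    have l0 := lip (x := t - s) (y := t - (j * I.T - I.CL)) (by linarith)
    have m0 := mono (x := t - (j * I.T - I.CL) - I.T) (y := t - s) (by linarith)
    rcases I.sbfA_le_or_exists_period tE t with ⟨hE, hA⟩ | ⟨n, hn1, hn2⟩
    · refine hA.trans (max_le hS ?_)
      have hj : (j : ℝ) < 1 := by nlinarith
      have hj0 : j ≤ 0 := by
        have : j < 1 := by exact_mod_cast hj
        omega
      have hjm : -2 < j := by
        have : (-2 : ℝ) < j := by nlinarith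
        exact_mod_cast this
      obtain rfl | rfl : j = 0 ∨ j = -1 := by omega
      · push_cast at *
        simp only [zero_mul, zero_sub, sub_neg_eq_add] at *
        rw [show t - (I.T - I.CL) = t + I.CL - I.T by ring]
        rcases min_cases I.CL (s + I.CL) with hm | hm <;> linarith
      · push_cast at *
        have := mono (x := t - (I.T - I.CL)) (y := t - s - I.T) (by linarith)
        have := add (t - s - I.T)
        rw [sub_add_cancel] at this
        rw [min_eq_left (by linarith)] at h
        linarith
    · obtain ⟨hA1, hA2⟩ := I.sbfA_le h1 n hn1 hn2
      have hnj1 : (n : ℝ) + 1 < j + 2 := by nlinarith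
      have hnj2 : (j : ℝ) < n + 2 := by nlinarith
      have hnj : (n : ℤ) + 1 = j ∨ (n : ℤ) = j := by
        have h1 : (n : ℤ) + 1 < j + 2 := by exact_mod_cast hnj1
        have h2 : j < (n : ℤ) + 2 := by exact_mod_cast hnj2
        omega
      rcases hnj with rfl | rfl
      · push_cast at *
        rw [show ((n : ℝ) + 1) * I.T - I.CL = n * I.T + I.T - I.CL by ring] at *
        rcases min_cases I.CL (s - (n * I.T + I.T - I.CL)) with hm | hm
        · have := hA2 (by linarith)
          rw [hm.1] at h
          have := max_le hts m0
          linarith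
        · linarith
      · push_cast at *
        rw [show t - (n * I.T + I.T - I.CL) = t - (n * I.T - I.CL) - I.T by ring] at *
        rcases min_cases I.CL (s - (n * I.T - I.CL)) with hm | hm <;> linarith
  · obtain ⟨j, hj1, hj2⟩ := exists_period hT (s + I.CL)
    rw [periodicSupply_eq_min hT hCL hCLT j (by linarith) (by linarith)] at h
    have hjm : -2 < j := by
      have : (-2 : ℝ) < j := by nlinarith
      exact_mod_cast this
    have hmax := le_max_left 0 (periodicSupply I.T I.CH (t - s - I.T))
    -- On the rise, moving `s` back to `j * T - CL` lowers the value; pattern A bounds the result.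
    rcases le_or_gt (s - (j * I.T - I.CL)) I.CL with hd | hd
    · refine (min_le_left _ _).trans ?_
      rw [min_eq_right hd] at h
      have l0 := lip (x := t - s - I.T) (y := t - (j * I.T - I.CL) - I.T) (by linarith)
      have key : j * I.CL + max 0 (periodicSupply I.T I.CH (t - (j * I.T - I.CL) - I.T)) ≤ S := by
        have := le_max_right 0 (periodicSupply I.T I.CH (t - s - I.T))
        rcases max_cases 0 (periodicSupply I.T I.CH (t - (j * I.T - I.CL) - I.T)) with hm | hm <;>
          linarith
      rcases I.sbfA_le_or_exists_period tE t with ⟨hE, hA⟩ | ⟨n, hn1, hn2⟩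
      · refine hA.trans ?_
        have hj : (j : ℝ) < 1 := by nlinarith
        have hj0 : j ≤ 0 := by
          have : j < 1 := by exact_mod_cast hj
          omega
        obtain rfl | rfl : j = 0 ∨ j = -1 := by omega
        · push_cast at key
          rw [show t - (I.T - I.CL) = t - (0 * I.T - I.CL) - I.T by ring]
          linarith
        · push_cast at *
          linarith
      · obtain ⟨hA1, hA2⟩ := I.sbfA_le h1 n hn1 hn2
        have hnj1 : (n : ℝ) + 1 < j + 2 := by nlinarith
        have hnj2 : (j : ℝ) < n + 2 := by nlinarith
        have hnj : (n : ℤ) + 1 = j ∨ (n : ℤ) = j := by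
          have h1 : (n : ℤ) + 1 < j + 2 := by exact_mod_cast hnj1
          have h2 : j < (n : ℤ) + 2 := by exact_mod_cast hnj2
          omega
        rcases hnj with rfl | rfl
        · push_cast at *
          rw [show ((n : ℝ) + 1) * I.T - I.CL = n * I.T + I.T - I.CL by ring] at *
          have := hA2 (by linarith)
          linarith
        · push_cast at *
          rw [show t - (n * I.T + I.T - I.CL) = t - (n * I.T - I.CL) - I.T by ring] at *
          have := le_max_right 0 (periodicSupply I.T I.CH (t - (n * I.T - I.CL) - I.T))
          linarith
    · rw [min_eq_left hd.le] at h
      have hCLlt : I.CL < I.T := by linarith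
      -- On the flat stretch `s` can grow up to `tE - CL` or up to the end of the segment, whichever
      -- comes first. The former is pattern B, the latter pattern A.
      rcases lt_or_ge tE ((j + 1) * I.T) with hE | hE
      · refine (min_le_right _ _).trans ((I.sbfB_le h0 h1 hCLlt).trans ?_)
        have hc : (⌈tE / I.T⌉ : ℝ) ≤ j + 1 := by
          have : ⌈tE / I.T⌉ ≤ j + 1 := by
            rw [Int.ceil_le, div_le_iff₀ hT]
            push_cast
            exact hE.le
          exact_mod_cast this
        have := mul_le_mul_of_nonneg_right hc hCL
        have m1 := mono (x := t - tE + I.CL - I.T) (y := t - s - I.T) (by linarith)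
        have := max_le_max_left 0 m1
        linarith
      · refine (min_le_left _ _).trans ?_
        rcases I.sbfA_le_or_exists_period tE t with ⟨hE', hA⟩ | ⟨n, hn1, hn2⟩
        · have hj : (j : ℝ) < 0 := by nlinarith
          have hj0 : j < 0 := by exact_mod_cast hj
          obtain rfl : j = -1 := by omega
          push_cast at *
          refine hA.trans ?_
          have m1 := mono (x := t - (I.T - I.CL)) (y := t - s - I.T) (by linarith)
          have := max_le_max_left 0 m1
          linarith
        · obtain ⟨hA1, hA2⟩ := I.sbfA_le h1 n hn1 hn2
          have hnj1 : (n : ℝ) + 1 < j + 2 := by nlinarith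
          have hnj2 : (j : ℝ) < n + 1 := by nlinarith
          have hnj : (n : ℤ) = j := by
            have h1 : (n : ℤ) + 1 < j + 2 := by exact_mod_cast hnj1
            have h2 : j < (n : ℤ) + 1 := by exact_mod_cast hnj2
            omega
          subst hnj
          push_cast at *
          have := hA2 (by linarith)
          have m1 := mono (x := t - (n * I.T + I.T - I.CL) - I.T) (y := t - s - I.T) (by linarith)
          have := max_le_max_left 0 m1
          linarith

end MCPR

/-! ### Demand bounds of a single task -/

/-- Releases of a sporadic task are separated by the minimum separation per job. -/
def Separated (T : ℝ) (r : ℕ → ℝ) : Prop := ∀ k l : ℕ, k < l → r k + (l - k) * T ≤ r l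

theorem Separated.card_sub_one_mul_le {T : ℝ} {r : ℕ → ℝ} (h : Separated T r) (hT : 0 ≤ T)
    {K : Finset ℕ} {x y : ℝ} (hK : K.Nonempty) (hx : ∀ k ∈ K, x ≤ r k) (hy : ∀ k ∈ K, r k ≤ y) :
    ((K.card : ℝ) - 1) * T ≤ y - x := by
  have hmin := K.min'_mem hK
  have hmax := K.max'_mem hK
  have hsub : K ⊆ Finset.Icc (K.min' hK) (K.max' hK) := fun k hk =>
    Finset.mem_Icc.2 ⟨K.min'_le k hk, K.le_max' k hk⟩
  have hle := K.min'_le _ hmax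
  have hcard := Finset.card_le_card hsub
  rw [Nat.card_Icc] at hcard
  have hcard' : (K.card : ℝ) - 1 ≤ (K.max' hK : ℝ) - K.min' hK := by
    have : K.card + K.min' hK ≤ K.max' hK + 1 := by omega
    have : ((K.card + K.min' hK : ℕ) : ℝ) ≤ ((K.max' hK + 1 : ℕ) : ℝ) := by exact_mod_cast this
    push_cast at this
    linarith
  have h1 := hx _ hmin
  have h2 := hy _ hmax
  have h3 : r (K.min' hK) + ((K.max' hK : ℝ) - K.min' hK) * T ≤ r (K.max' hK) := by
    rcases hle.eq_or_lt with he | hlt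
    · rw [← he]; simp
    · exact h _ _ hlt
  nlinarith

namespace Task

variable (τ : Task)

theorem CH_ge_CL : τ.CL ≤ τ.CH := by
  cases h : τ.level with
  | LC => exact (τ.CL_eq_CH_of_LC h).le
  | HC => exact (τ.CL_lt_CH_of_HC h).le

theorem CH_pos : 0 < τ.CH := τ.CL_pos.trans_le τ.CH_ge_CL

theorem DL_pos : 0 < τ.DL := τ.CL_pos.trans_le τ.CL_le_DL

theorem D_pos : 0 < τ.D := τ.DL_pos.trans_le τ.DL_le_D

theorem T_pos : 0 < τ.T := τ.D_pos.trans_le τ.D_le_T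

theorem floor_bounds (v : ℝ) : (⌊v / τ.T⌋ : ℝ) * τ.T ≤ v ∧ v < (⌊v / τ.T⌋ : ℝ) * τ.T + τ.T := by
  have h1 := Int.floor_le (v / τ.T)
  have h2 := Int.lt_floor_add_one (v / τ.T)
  rw [le_div_iff₀ τ.T_pos] at h1
  rw [div_lt_iff₀ τ.T_pos] at h2
  exact ⟨h1, by linarith⟩

theorem dbfJobB_nonneg {t ti r : ℝ} (h : r ≤ ti) : 0 ≤ τ.dbfJobB t ti r := by
  unfold dbfJobB
  split_ifs
  · exact le_min (by linarith) τ.CL_pos.le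
  · exact le_rfl

theorem dbfJobB_le (t ti r : ℝ) : τ.dbfJobB t ti r ≤ τ.CL := by
  unfold dbfJobB
  split_ifs
  · exact min_le_right _ _
  · exact τ.CL_pos.le

theorem dbfJobA_le (t ti r : ℝ) : τ.dbfJobA t ti r ≤ τ.CH := by
  have := τ.CH_ge_CL
  unfold dbfJobA
  split_ifs
  · exact this
  · exact le_rfl
  · exact (min_le_right _ _).trans this
  · exact τ.CH_pos.le

theorem dbfJobB_le_dbfJobA (t ti r : ℝ) : τ.dbfJobB t ti r ≤ τ.dbfJobA t ti r := by
  have h1 := τ.CH_ge_CL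
  have h2 := τ.CL_pos
  have h3 := τ.DL_le_D
  unfold dbfJobA
  split_ifs with c1 c2 c3
  · exact τ.dbfJobB_le _ _ _
  · exact (τ.dbfJobB_le _ _ _).trans h1
  · simp [dbfJobB, c3]
  · simp [dbfJobB, c3]

theorem dbfA_le_dbfB (t ti : ℝ) : τ.dbfA t ti ≤ τ.dbfB t ti := by
  have := τ.dbfJobB_le_dbfJobA t ti ((⌊ti / τ.T⌋ : ℝ) * τ.T)
  unfold dbfA dbfB
  linarith

/-- The last job may be cut short at `x`, but once a further release fits before `y` it counts in
full. -/
theorem dbfA_mono (t : ℝ) {x y : ℝ} (h : x ≤ y) : τ.dbfA t x ≤ τ.dbfA t y := by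
  have hx := τ.floor_bounds x
  have hy := τ.floor_bounds y
  have hle : ⌊x / τ.T⌋ ≤ ⌊y / τ.T⌋ :=
    Int.floor_le_floor (div_le_div_of_nonneg_right h τ.T_pos.le)
  unfold dbfA
  rcases hle.eq_or_lt with he | hlt
  · rw [← he]
    unfold dbfJobB
    split_ifs
    · gcongr
    · exact le_rfl
  · have hlt' : (⌊x / τ.T⌋ : ℝ) + 1 ≤ ⌊y / τ.T⌋ := by exact_mod_cast hlt
    have h1 := τ.dbfJobB_le t x ((⌊x / τ.T⌋ : ℝ) * τ.T)
    have h2 := τ.dbfJobB_nonneg (t := t) hy.1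
    have := mul_le_mul_of_nonneg_right hlt' τ.CL_pos.le
    linarith

theorem dbfA_nonneg (t : ℝ) {ti : ℝ} (h : 0 ≤ ti) : 0 ≤ τ.dbfA t ti := by
  have h1 : (0 : ℝ) ≤ ⌊ti / τ.T⌋ := by
    exact_mod_cast Int.floor_nonneg.2 (div_nonneg h τ.T_pos.le)
  have h2 := τ.dbfJobB_nonneg (t := t) (τ.floor_bounds ti).1
  have := mul_nonneg h1 τ.CL_pos.le
  unfold dbfA
  linarith

theorem dbfA_le_linear (t ti : ℝ) : τ.dbfA t ti ≤ τ.CL / τ.T * ti + τ.CL := by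
  have h1 := τ.dbfJobB_le t ti ((⌊ti / τ.T⌋ : ℝ) * τ.T)
  have h2 := mul_le_mul_of_nonneg_right (Int.floor_le (ti / τ.T)) τ.CL_pos.le
  unfold dbfA
  rw [show τ.CL / τ.T * ti = ti / τ.T * τ.CL by ring]
  linarith

theorem floor_sub_D (t : ℝ) :
    τ.offset t + (⌊(t - τ.D) / τ.T⌋ : ℝ) * τ.T = t - τ.D := by
  unfold offset
  ring

/-- Demand of the pattern ending with a deadline at `t`, in terms of the number `aNum` of jobs
released after the switch. -/
theorem dbfC_eq (t ti : ℝ) : τ.dbfC t ti = (⌊(t - τ.D) / τ.T⌋ : ℝ) * τ.CL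
    + (τ.aNum t ti : ℝ) * (τ.CH - τ.CL) + τ.dbfJobA t ti (t - τ.D - τ.aNum t ti * τ.T) := by
  have h : τ.offset t + (τ.bNum t ti : ℝ) * τ.T = t - τ.D - τ.aNum t ti * τ.T := by
    rw [← τ.floor_sub_D t, aNum]
    push_cast
    ring
  unfold dbfC
  rw [h, aNum]
  push_cast
  ring

theorem aNum_bounds (t ti : ℝ) : t - τ.D - τ.aNum t ti * τ.T ≤ ti ∧
    ti < t - τ.D - τ.aNum t ti * τ.T + τ.T := by
  have h := τ.floor_bounds (ti - τ.offset t)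
  have e := τ.floor_sub_D t
  have hb : (τ.aNum t ti : ℝ) = ⌊(t - τ.D) / τ.T⌋ - ⌊(ti - τ.offset t) / τ.T⌋ := by
    rw [aNum, bNum]; push_cast; rfl
  rw [hb]
  constructor <;> nlinarith

theorem aNum_nonneg {t ti : ℝ} (h : ti < t - τ.D + τ.T) : 0 ≤ τ.aNum t ti := by
  have h1 := (τ.aNum_bounds t ti).1
  have : (-1 : ℝ) < τ.aNum t ti := by nlinarith [τ.T_pos]
  have : (-1 : ℤ) < τ.aNum t ti := by exact_mod_cast this
  omega

theorem dbfJobA_aNum {t ti : ℝ} (h : ti < t - τ.D + τ.T) :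
    τ.dbfJobA t ti (t - τ.D - τ.aNum t ti * τ.T) =
      if t - τ.D - τ.aNum t ti * τ.T + τ.DL < ti then τ.CL else τ.CH := by
  have h0 : (0 : ℝ) ≤ τ.aNum t ti := by exact_mod_cast τ.aNum_nonneg h
  have := mul_nonneg h0 τ.T_pos.le
  unfold dbfJobA
  rw [if_pos (show t - τ.D - τ.aNum t ti * τ.T + τ.D ≤ t by linarith)]

/-- A later switch turns jobs counted with `CH` into jobs counted with `CL`. The bound on `y` makes
`aNum` nonnegative, so the last job before the switch is due by `t` and `dbfJobA` is `CL` or `CH`.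
-/
theorem dbfC_antitone {t x y : ℝ} (hxy : x ≤ y) (hy : y < t - τ.D + τ.T) :
    τ.dbfC t y ≤ τ.dbfC t x := by
  have h0 := τ.CH_ge_CL
  rw [dbfC_eq, dbfC_eq, τ.dbfJobA_aNum hy, τ.dbfJobA_aNum (hxy.trans_lt hy)]
  have hx' := τ.aNum_bounds t x
  have hy' := τ.aNum_bounds t y
  have hle : τ.aNum t y ≤ τ.aNum t x := by
    have : (τ.aNum t y : ℝ) < τ.aNum t x + 1 := by
      by_contra! hc
      nlinarith [τ.T_pos]
    have : τ.aNum t y < τ.aNum t x + 1 := by exact_mod_cast this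
    omega
  rcases hle.eq_or_lt with he | hlt
  · rw [he]
    have : (if t - τ.D - τ.aNum t x * τ.T + τ.DL < y then τ.CL else τ.CH) ≤
        if t - τ.D - τ.aNum t x * τ.T + τ.DL < x then τ.CL else τ.CH := by
      split_ifs <;> linarith
    linarith
  · have hlt' : (τ.aNum t y : ℝ) + 1 ≤ τ.aNum t x := by exact_mod_cast hlt
    have := mul_le_mul_of_nonneg_right hlt' (sub_nonneg.2 h0)
    split_ifs <;> linarith

theorem dbf_HC_of_le {t ti : ℝ} (h : τ.level = Level.HC) (h1 : τ.D - τ.DL ≤ t - ti) :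
    τ.dbfC t ti ≤ τ.dbf t ti := by
  unfold dbf
  rw [h]
  dsimp only
  rw [if_neg (not_lt.2 h1)]
  split_ifs
  · exact le_rfl
  · exact le_max_right _ _

theorem floor_sub_D_ge {t : ℝ} (ht : 0 ≤ t) : -1 ≤ ⌊(t - τ.D) / τ.T⌋ := by
  rw [Int.le_floor, le_div_iff₀ τ.T_pos]
  have := τ.D_le_T
  push_cast
  linarith

theorem dbfA_le_dbf_HC {t ti : ℝ} (h : τ.level = Level.HC) :
    τ.dbfA t ti ≤ τ.dbf t ti := by
  have hAB := τ.dbfA_le_dbfB t ti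
  have hDL := τ.DL_pos
  unfold dbf
  rw [h]
  dsimp only
  split_ifs with c1 c2
  · exact hAB
  -- As `ti ≤ t - D`, the pattern aligned with `t` has at least `⌊ti / T⌋ + 1` jobs, each counted
  -- with at least `CL`.
  · have hlt : ti < t - τ.D + τ.T := by linarith [τ.T_pos]
    rw [dbfC_eq, τ.dbfJobA_aNum hlt]
    have ha : (0 : ℝ) ≤ τ.aNum t ti := by exact_mod_cast τ.aNum_nonneg hlt
    have hCC := τ.CH_ge_CL
    have h1 := mul_nonneg ha (sub_nonneg.2 hCC)
    have hfl : (⌊ti / τ.T⌋ : ℝ) ≤ ⌊(t - τ.D) / τ.T⌋ := by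
      exact_mod_cast Int.floor_le_floor (div_le_div_of_nonneg_right (by linarith) τ.T_pos.le)
    have h2 := mul_le_mul_of_nonneg_right hfl τ.CL_pos.le
    have h3 := τ.dbfJobB_le t ti ((⌊ti / τ.T⌋ : ℝ) * τ.T)
    unfold dbfA
    split_ifs <;> linarith
  · exact hAB.trans (le_max_left _ _)

/-- The constant comes from `dbfC`: at most `(t - D + T - ti) / T` jobs count with `CH` instead of
`CL`, and one further job is bounded by `CH`. -/
theorem dbf_HC_le_linear {t ti : ℝ} (h : τ.level = Level.HC) (h1 : ti ≤ t) :
    τ.dbf t ti ≤ τ.CL / τ.T * ti + τ.CH / τ.T * (t - ti)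
      + τ.CH * (2 * τ.T - τ.D) / τ.T := by
  have hT := τ.T_pos
  have hCC := τ.CH_ge_CL
  have hCL := τ.CL_pos
  have hDT := τ.D_le_T
  obtain ⟨p, hp⟩ : ∃ p, p = τ.CL / τ.T := ⟨_, rfl⟩
  obtain ⟨q, hq⟩ : ∃ q, q = τ.CH / τ.T := ⟨_, rfl⟩
  have ep : τ.CL = p * τ.T := by rw [hp]; field_simp
  have eq' : τ.CH = q * τ.T := by rw [hq]; field_simp
  have hp0 : 0 < p := hp ▸ div_pos hCL hT
  have hpq : p ≤ q := by rw [hp, hq]; exact div_le_div_of_nonneg_right hCC hT.le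
  have hrhs : τ.CL / τ.T * ti + τ.CH / τ.T * (t - ti) + τ.CH * (2 * τ.T - τ.D) / τ.T =
      p * ti + q * (t - ti) + q * (2 * τ.T - τ.D) := by
    rw [← hp, ← hq, hq]; ring
  rw [hrhs]
  have hB : τ.dbfB t ti ≤ p * ti + q * (t - ti) + q * (2 * τ.T - τ.D) := by
    have h2 := τ.dbfJobA_le t ti ((⌊ti / τ.T⌋ : ℝ) * τ.T)
    have h3 := (τ.floor_bounds ti).1
    unfold dbfB
    rw [ep]
    rw [eq'] at h2
    nlinarith
  have hC : τ.dbfC t ti ≤ p * ti + q * (t - ti) + q * (2 * τ.T - τ.D) := by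
    have h2 := τ.dbfJobA_le t ti (t - τ.D - τ.aNum t ti * τ.T)
    have h3 := (τ.aNum_bounds t ti).2
    have h4 := (τ.floor_bounds (t - τ.D)).1
    rw [dbfC_eq]
    have e1 : (⌊(t - τ.D) / τ.T⌋ : ℝ) * τ.CL ≤ p * (t - τ.D) := by rw [ep]; nlinarith
    have e2 : (τ.aNum t ti : ℝ) * (τ.CH - τ.CL) ≤ (q - p) * (t - τ.D + τ.T - ti) := by
      rw [ep, eq']
      nlinarith
    rw [eq'] at h2
    nlinarith [τ.D_pos]
  unfold dbf
  rw [h]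
  dsimp only
  split_ifs
  · exact hB
  · exact hC
  · exact max_le hB hC

end Task

/-! ### Demand of the jobs of one task in a window -/

namespace Task

variable (τ : Task)

/-- `Y k` bounds from above by what the job of task `τ` released at `r k` may execute with priority
in a window `[0, t)`, when the task switches to `HC` mode (or is dropped) at `ti`. -/
structure JobBound (t ti : ℝ) (r : ℕ → ℝ) (Y : ℕ → ℝ) (k : ℕ) : Prop where
  nonpos_of_lt : t < r k + τ.DL → Y k ≤ 0
  le_CH : Y k ≤ τ.CH
  le_of_late : t < r k + τ.D → Y k ≤ τ.CL ∧ Y k ≤ max 0 (ti - r k)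
  le_of_before : r k + τ.DL < ti → Y k ≤ τ.CL
  le_of_due : r k + τ.D ≤ ti → r k + τ.D ≤ t - τ.D → Y k ≤ τ.CL
  le_of_end : ti = t → Y k ≤ τ.CL

/-- Separation leaves room for at most `⌊ti / T⌋ + 1` jobs. If all are present, the last is released
no earlier than `⌊ti / T⌋ * T`, so it has no more room before `ti` than in the pattern. -/
theorem sum_le_dbfA {t ti : ℝ} {r Y : ℕ → ℝ} {K : Finset ℕ} (hr : Separated τ.T r)
    (hti : 0 ≤ ti) (h0 : ∀ k ∈ K, 0 ≤ r k) (h1 : ∀ k ∈ K, Y k ≤ τ.CL)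
    (h2 : ∀ k ∈ K, (∀ l ∈ K, l ≤ k) → r k ≤ ti ∧ Y k ≤ ti - r k ∧ r k + τ.DL ≤ t) :
    ∑ k ∈ K, Y k ≤ τ.dbfA t ti := by
  rcases K.eq_empty_or_nonempty with rfl | hK
  · simpa using τ.dbfA_nonneg t hti
  have hT := τ.T_pos
  have hCL := τ.CL_pos
  have hmem := K.max'_mem hK
  obtain ⟨h3, h4, h5⟩ := h2 _ hmem fun l hl => K.le_max' l hl
  have hmono : ∀ k ∈ K, r k ≤ r (K.max' hK) := by
    intro k hk
    rcases (K.le_max' k hk).eq_or_lt with he | hlt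
    · rw [← he]
    · have h := hr k _ hlt
      have : (0 : ℝ) ≤ (K.max' hK : ℝ) - k := by
        have : (k : ℝ) ≤ K.max' hK := by exact_mod_cast hlt.le
        linarith
      have := mul_nonneg this hT.le
      linarith
  have hcard := hr.card_sub_one_mul_le hT.le hK h0 hmono
  rw [sub_zero] at hcard
  have hsum : ∑ k ∈ K, Y k ≤ ((K.card : ℝ) - 1) * τ.CL + Y (K.max' hK) := by
    rw [← Finset.sum_erase_add _ _ hmem]
    gcongr
    have h := Finset.sum_le_card_nsmul (K.erase (K.max' hK)) Y τ.CL
      fun k hk => h1 k (Finset.mem_of_mem_erase hk)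
    rw [Finset.card_erase_of_mem hmem, nsmul_eq_mul,
      Nat.cast_sub (Finset.one_le_card.2 hK), Nat.cast_one] at h
    exact h
  have hm := τ.floor_bounds ti
  have hB := τ.dbfJobB_nonneg (t := t) hm.1
  have hlt : (K.card : ℝ) - 1 < ⌊ti / τ.T⌋ + 1 := by
    by_contra! hc
    nlinarith
  have hle : (K.card : ℤ) - 1 ≤ ⌊ti / τ.T⌋ := by
    have : (K.card : ℤ) - 1 < ⌊ti / τ.T⌋ + 1 := by exact_mod_cast hlt
    omega
  have h6 := h1 _ hmem
  unfold dbfA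
  rcases hle.eq_or_lt with he | hlt
  · have he' : (K.card : ℝ) - 1 = ⌊ti / τ.T⌋ := by exact_mod_cast he
    rw [he'] at hsum hcard
    unfold dbfJobB
    rw [if_pos (by linarith)]
    have : Y (K.max' hK) ≤ min (ti - (⌊ti / τ.T⌋ : ℝ) * τ.T) τ.CL := le_min (by linarith) h6
    linarith
  · have : (K.card : ℝ) - 1 + 1 ≤ ⌊ti / τ.T⌋ := by exact_mod_cast hlt
    nlinarith

theorem sum_le_dbf_LC {t ti : ℝ} {r Y : ℕ → ℝ} {K : Finset ℕ} (h : τ.level = Level.LC)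
    (hr : Separated τ.T r) (hti : 0 ≤ ti) (h0 : ∀ k ∈ K, 0 ≤ r k)
    (h1 : ∀ k ∈ K, Y k ≤ τ.CL) (h2 : ∀ k ∈ K, Y k ≤ max 0 (ti - r k))
    (h3 : ∀ k ∈ K, t < r k + τ.D → Y k ≤ 0) :
    ∑ k ∈ K, Y k ≤ τ.dbf t ti := by
  have hdbf : τ.dbf t ti = τ.dbfA t ti := by unfold dbf; rw [h]
  have hle : ∑ k ∈ K, Y k ≤ ∑ k ∈ K with 0 < Y k, Y k := by
    rw [Finset.sum_filter]
    refine Finset.sum_le_sum fun k _ => ?_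
    split_ifs <;> linarith
  rw [hdbf]
  refine hle.trans (τ.sum_le_dbfA hr hti (fun k hk => h0 k (Finset.mem_filter.1 hk).1)
    (fun k hk => h1 k (Finset.mem_filter.1 hk).1) fun k hk _ => ?_)
  obtain ⟨hk, hpos⟩ := Finset.mem_filter.1 hk
  have h4 := h2 k hk
  have h5 := h3 k hk
  rw [← τ.DL_eq_D_of_LC h] at h5
  have h6 : 0 ≤ ti - r k := by
    by_contra! hc
    rw [max_eq_left hc.le] at h4
    linarith
  rw [max_eq_right h6] at h4
  refine ⟨by linarith, h4, ?_⟩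
  by_contra! hc
  linarith [h5 hc]

/-- Two counts suffice: all jobs at `CL`, and those exceeding `CL` at an extra `CH - CL`. Jobs of
the second kind have their tightened deadline at or after `ti`, so separation limits them to `aNum`
or `aNum + 1`. -/
theorem sum_le_dbfC {t ti : ℝ} {r Y : ℕ → ℝ} {K : Finset ℕ} (hr : Separated τ.T r)
    (ht : 0 ≤ t) (htt : ti < t) (h0 : ∀ k ∈ K, 0 ≤ r k) (hY : ∀ k ∈ K, τ.JobBound t ti r Y k)
    (h1 : ∀ k ∈ K, r k + τ.D ≤ t) : ∑ k ∈ K, Y k ≤ τ.dbfC t ti := by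
  have hT := τ.T_pos
  have hDT := τ.D_le_T
  have hDL := τ.DL_le_D
  have hCC := τ.CH_ge_CL
  have hCL := τ.CL_pos
  have hlt : ti < t - τ.D + τ.T := by linarith
  have ha := τ.aNum_nonneg hlt
  have ha' : (0 : ℝ) ≤ τ.aNum t ti := by exact_mod_cast ha
  have hab := τ.aNum_bounds t ti
  set N := K.filter fun k => τ.CL < Y k with hN
  have hsum : ∑ k ∈ K, Y k ≤ K.card * τ.CL + N.card * (τ.CH - τ.CL) := by
    have : ∑ k ∈ K, Y k ≤ ∑ k ∈ K, (τ.CL + if τ.CL < Y k then τ.CH - τ.CL else 0) := by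
      refine Finset.sum_le_sum fun k hk => ?_
      have := (hY k hk).le_CH
      split_ifs <;> linarith
    rw [Finset.sum_add_distrib, ← Finset.sum_filter] at this
    rwa [Finset.sum_const, Finset.sum_const, nsmul_eq_mul, nsmul_eq_mul] at this
  have hF : (K.card : ℤ) ≤ ⌊(t - τ.D) / τ.T⌋ + 1 := by
    rcases K.eq_empty_or_nonempty with rfl | hK
    · have := τ.floor_sub_D_ge ht
      simp; omega
    · have h := hr.card_sub_one_mul_le hT.le hK h0 (y := t - τ.D)
        fun k hk => by linarith [h1 k hk]
      have : (K.card : ℤ) - 1 ≤ ⌊(t - τ.D) / τ.T⌋ := by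
        rw [Int.le_floor, le_div_iff₀ hT]
        push_cast
        linarith
      omega
  have hF' : (K.card : ℝ) ≤ ⌊(t - τ.D) / τ.T⌋ + 1 := by exact_mod_cast hF
  have hFm := mul_le_mul_of_nonneg_right hF' hCL.le
  have hNmem : ∀ k ∈ N, ti ≤ r k + τ.DL ∧ (r k + τ.D ≤ ti → t - τ.D < r k + τ.D) ∧
      r k ≤ t - τ.D ∧ 0 ≤ r k := by
    intro k hk
    obtain ⟨hk, hlt⟩ := Finset.mem_filter.1 hk
    have hb := hY k hk
    refine ⟨?_, fun h => ?_, by linarith [h1 k hk], h0 k hk⟩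
    · by_contra! hc
      linarith [hb.le_of_before hc]
    · by_contra! hc
      linarith [hb.le_of_due h hc]
  have hNT : N.Nonempty → ((N.card : ℝ) - 1) * τ.T ≤ (t - τ.D) - (ti - τ.DL) := fun hne =>
    hr.card_sub_one_mul_le hT.le hne (fun k hk => by linarith [(hNmem k hk).1])
      fun k hk => (hNmem k hk).2.2.1
  rw [dbfC_eq, τ.dbfJobA_aNum hlt]
  split_ifs with hc
  · have hNa : (N.card : ℝ) ≤ τ.aNum t ti := by
      rcases N.eq_empty_or_nonempty with he | hne
      · rw [he]; simpa using ha'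
      · have h := hNT hne
        have : (N.card : ℝ) - 1 < τ.aNum t ti := by
          by_contra! hcc
          nlinarith
        have : (N.card : ℤ) - 1 < τ.aNum t ti := by exact_mod_cast this
        have : (N.card : ℤ) ≤ τ.aNum t ti := by omega
        exact_mod_cast this
    have := mul_le_mul_of_nonneg_right hNa (sub_nonneg.2 hCC)
    linarith
  · have hNa : (N.card : ℝ) ≤ τ.aNum t ti + 1 := by
      rcases N.eq_empty_or_nonempty with he | hne
      · rw [he]; simp; linarith
      · have h := hNT hne
        by_contra! hcc
        have hcc' : τ.aNum t ti + 1 < (N.card : ℤ) := by exact_mod_cast hcc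
        have h3 : (τ.aNum t ti : ℝ) + 2 ≤ N.card := by
          have : τ.aNum t ti + 2 ≤ (N.card : ℤ) := by omega
          exact_mod_cast this
        -- With `aNum + 2` such jobs, the first would be due by `ti` and by `t - D`. Then
        -- `le_of_due` limits it to `CL`.
        have hmin := N.min'_mem hne
        obtain ⟨m1, m2, m3, m4⟩ := hNmem _ hmin
        have hspan := hr.card_sub_one_mul_le hT.le hne (x := r (N.min' hne)) (y := t - τ.D)
          (fun k hk => by
            rcases (N.min'_le k hk).eq_or_lt with he | hlt
            · rw [he]
            · have h := hr _ k hlt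
              have : (0 : ℝ) ≤ (k : ℝ) - N.min' hne := by
                have : ((N.min' hne : ℕ) : ℝ) ≤ k := by exact_mod_cast hlt.le
                linarith
              have := mul_nonneg this hT.le
              linarith)
          fun k hk => (hNmem k hk).2.2.1
        have h4 : ((τ.aNum t ti : ℝ) + 1) * τ.T ≤ ((N.card : ℝ) - 1) * τ.T :=
          mul_le_mul_of_nonneg_right (by linarith) hT.le
        have h5 := mul_nonneg ha' hT.le
        have := m2 (by nlinarith)
        nlinarith
    have := mul_le_mul_of_nonneg_right hNa (sub_nonneg.2 hCC)
    linarith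

/-- The demand of an `HC` task that switches between `x` and `y` is bounded by its demand bound for
a switch at `x` or at `y`. -/
theorem sum_le_max_dbf_HC {t x ti y : ℝ} {r Y : ℕ → ℝ} {K : Finset ℕ} (h : τ.level = Level.HC)
    (hr : Separated τ.T r) (hti : 0 ≤ ti) (hx : x ≤ ti) (hy : ti ≤ y) (hyt : y ≤ t)
    (h0 : ∀ k ∈ K, 0 ≤ r k) (hY : ∀ k ∈ K, τ.JobBound t ti r Y k) :
    ∑ k ∈ K, Y k ≤ max (τ.dbf t x) (τ.dbf t y) := by
  have hT := τ.T_pos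
  have hDT := τ.D_le_T
  have hDL := τ.DL_le_D
  have hCLD := τ.CL_le_DL
  have hA : τ.dbfA t ti ≤ max (τ.dbf t x) (τ.dbf t y) :=
    (τ.dbfA_mono t hy).trans ((τ.dbfA_le_dbf_HC h).trans (le_max_right _ _))
  set K' := K.filter fun k => 0 < Y k with hK'
  have hle : ∑ k ∈ K, Y k ≤ ∑ k ∈ K', Y k := by
    rw [hK', Finset.sum_filter]
    refine Finset.sum_le_sum fun k _ => ?_
    split_ifs <;> linarith
  refine hle.trans ?_
  have hmem : ∀ k ∈ K', 0 ≤ r k ∧ τ.JobBound t ti r Y k ∧ r k + τ.DL ≤ t ∧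
      (t < r k + τ.D → r k < ti ∧ Y k ≤ ti - r k) := by
    intro k hk
    obtain ⟨hk, hpos⟩ := Finset.mem_filter.1 hk
    have hb := hY k hk
    refine ⟨h0 k hk, hb, ?_, fun hl => ?_⟩
    · by_contra! hc
      linarith [hb.nonpos_of_lt hc]
    · have := (hb.le_of_late hl).2
      have h6 : 0 < ti - r k := by
        by_contra! hc
        rw [max_eq_left hc] at this
        linarith
      rw [max_eq_right h6.le] at this
      exact ⟨by linarith, this⟩
  -- Either the jobs look like those of a task cut off at `ti`, and `dbfA` applies; or `dbfC`
  -- applies, once its three prerequisites are derived from the failure of this case.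
  by_cases hcase : (∀ k ∈ K', Y k ≤ τ.CL) ∧ (∀ k ∈ K', (∀ l ∈ K', l ≤ k) →
      r k ≤ ti ∧ Y k ≤ ti - r k)
  · refine le_trans ?_ hA
    exact τ.sum_le_dbfA hr hti (fun k hk => (hmem k hk).1) hcase.1 fun k hk hlast =>
      ⟨(hcase.2 k hk hlast).1, (hcase.2 k hk hlast).2, (hmem k hk).2.2.1⟩
  have htt : ti < t := by
    refine (hy.trans hyt).lt_of_ne fun he => hcase ⟨fun k hk => (hmem k hk).2.1.le_of_end he,
      fun k hk _ => ?_⟩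
    have h1 := (hmem k hk).2.1.le_of_end he
    have h2 := (hmem k hk).2.2.1
    have := τ.DL_pos
    constructor <;> linarith
  have hD : τ.D - τ.DL ≤ t - ti := by
    by_contra! hc
    refine hcase ⟨fun k hk => ?_, fun k hk _ => ?_⟩
    · rcases le_or_gt (r k + τ.D) t with hd | hd
      · exact (hmem k hk).2.1.le_of_before (by linarith)
      · exact ((hmem k hk).2.1.le_of_late hd).1
    · rcases le_or_gt (r k + τ.D) t with hd | hd
      · have := (hmem k hk).2.1.le_of_before (by linarith)
        have := τ.DL_pos
        constructor <;> linarith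
      · have := (hmem k hk).2.2.2 hd
        exact ⟨this.1.le, this.2⟩
  -- A contributing job due after `t` must have run before `ti`. It is then the last one, and all
  -- earlier jobs have their tightened deadlines before `ti`, which is the excluded case.
  have hall : ∀ k ∈ K', r k + τ.D ≤ t := by
    by_contra! hc
    obtain ⟨k₀, hk₀, hd⟩ := hc
    have hk₀' := (hmem k₀ hk₀).2.2.2 hd
    have hlast : ∀ l ∈ K', l ≤ k₀ := by
      intro l hl
      by_contra! hlt
      have hsep := hr k₀ l hlt
      have : (1 : ℝ) ≤ (l : ℝ) - k₀ := by
        have : (k₀ : ℝ) + 1 ≤ l := by exact_mod_cast hlt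
        linarith
      have := (hmem l hl).2.2.2 (by nlinarith)
      have := (hmem l hl).2.2.1
      nlinarith
    refine hcase ⟨fun k hk => ?_, fun k hk hk2 => ?_⟩
    · rcases (hlast k hk).eq_or_lt with he | hlt
      · rw [he]; exact ((hmem k₀ hk₀).2.1.le_of_late hd).1
      · have hsep := hr k k₀ hlt
        have : (1 : ℝ) ≤ (k₀ : ℝ) - k := by
          have : (k : ℝ) + 1 ≤ k₀ := by exact_mod_cast hlt
          linarith
        exact (hmem k hk).2.1.le_of_before (by nlinarith)
    · have : k = k₀ := le_antisymm (hlast k hk) (hk2 k₀ hk₀)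
      rw [this]
      exact ⟨hk₀'.1.le, hk₀'.2⟩
  have hC := τ.sum_le_dbfC hr (hti.trans htt.le) htt (fun k hk => (hmem k hk).1)
    (fun k hk => (hmem k hk).2.1) hall
  exact hC.trans ((τ.dbfC_antitone hx (by linarith)).trans
    ((τ.dbf_HC_of_le h (by linarith)).trans (le_max_left _ _)))

end Task

/-! ### Demand of the component and windows beyond `tMax` -/

namespace Component

variable {ι : Type*} [Fintype ι] (C : Component ι)

theorem mem_hcTasks {i : ι} : i ∈ C.hcTasks ↔ (C.task i).level = Level.HC := by
  simp [hcTasks]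

theorem mem_lcTasks {i : ι} : i ∈ C.lcTasks ↔ (C.task i).level = Level.LC := by
  simp [lcTasks]

theorem sum_hcTasks_add_sum_lcTasks (f : ι → ℝ) :
    ∑ i ∈ C.hcTasks, f i + ∑ i ∈ C.lcTasks, f i = ∑ i, f i := by
  have h : C.lcTasks = Finset.univ.filter fun i => ¬(C.task i).level = Level.HC := by
    unfold lcTasks
    congr 1
    ext i
    cases (C.task i).level <;> simp
  rw [h]
  exact Finset.sum_filter_add_sum_filter_not _ _ _

theorem sum_le_topSum {f : ι → ℝ} {G : Finset ι} (hG : G ⊆ C.hcTasks) (hc : G.card ≤ C.TL) :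
    ∑ i ∈ G, f i ≤ C.topSum f :=
  Finset.le_sup' (fun G => ∑ i ∈ G, f i)
    (Finset.mem_filter.2 ⟨Finset.mem_powerset.2 hG, hc⟩)

theorem topSum_le {f : ι → ℝ} {B : ℝ}
    (h : ∀ G, G ⊆ C.hcTasks → G.card ≤ C.TL → ∑ i ∈ G, f i ≤ B) : C.topSum f ≤ B := by
  refine Finset.sup'_le _ _ fun G hG => ?_
  obtain ⟨h1, h2⟩ := Finset.mem_filter.1 hG
  exact h G (Finset.mem_powerset.1 h1) h2

/-- Adding the positive part of the difference gives a selected task the larger of its bounds at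
`tI` and `tE`. Its linear bound at `tI` exceeds the one at `tE` by `(CH - CL) / T * (tE - tI)`. -/
theorem dbf_le_linear {t tE tI : ℝ} (hIE : tI ≤ tE) (hE : tE ≤ t) :
    C.dbf t tE tI ≤ C.demandConst + C.ULL * tI + C.UHL * tE + C.UHH * (t - tE)
      + C.extraU * (tE - tI) := by
  classical
  have hLC : ∑ i ∈ C.lcTasks, (C.task i).dbf t tI ≤
      C.ULL * tI + ∑ i ∈ C.lcTasks, (C.task i).CL := by
    unfold ULL
    rw [Finset.sum_mul, ← Finset.sum_add_distrib]
    refine Finset.sum_le_sum fun i hi => ?_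
    have h : (C.task i).dbf t tI = (C.task i).dbfA t tI := by
      unfold Task.dbf; rw [C.mem_lcTasks.1 hi]
    rw [h]
    exact (C.task i).dbfA_le_linear t tI
  have hTop : C.topSum (fun i => max 0 ((C.task i).dbf t tI - (C.task i).dbf t tE)) ≤
      C.UHL * tE + C.UHH * (t - tE)
      + ∑ i ∈ C.hcTasks, (C.task i).CH * (2 * (C.task i).T - (C.task i).D) / (C.task i).T
      + C.extraU * (tE - tI) - ∑ i ∈ C.hcTasks, (C.task i).dbf t tE := by
    refine C.topSum_le fun G hG hcard => ?_
    have hV : ∑ i ∈ G, ((C.task i).CH - (C.task i).CL) / (C.task i).T * (tE - tI) ≤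
        C.extraU * (tE - tI) := by
      rw [← Finset.sum_mul]
      exact mul_le_mul_of_nonneg_right (C.sum_le_topSum hG hcard) (by linarith)
    have hsub : ∀ f : ι → ℝ, ∑ i ∈ G, f i = ∑ i ∈ C.hcTasks, if i ∈ G then f i else 0 := by
      intro f
      rw [← Finset.sum_filter, Finset.filter_mem_eq_inter, Finset.inter_eq_right.2 hG]
    have hsum : ∑ i ∈ C.hcTasks, ((C.task i).dbf t tE +
        if i ∈ G then max 0 ((C.task i).dbf t tI - (C.task i).dbf t tE) else 0) ≤
        ∑ i ∈ C.hcTasks, ((C.task i).CL / (C.task i).T * tE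
          + (C.task i).CH / (C.task i).T * (t - tE)
          + (C.task i).CH * (2 * (C.task i).T - (C.task i).D) / (C.task i).T
          + if i ∈ G then ((C.task i).CH - (C.task i).CL) / (C.task i).T * (tE - tI) else 0) := by
      refine Finset.sum_le_sum fun i hi => ?_
      have h1 := (C.task i).dbf_HC_le_linear (C.mem_hcTasks.1 hi) hE
      split_ifs
      · have h2 := (C.task i).dbf_HC_le_linear (C.mem_hcTasks.1 hi) (hIE.trans hE)
        have h3 : 0 ≤ ((C.task i).CH - (C.task i).CL) / (C.task i).T * (tE - tI) :=
          mul_nonneg (div_nonneg (sub_nonneg.2 (C.task i).CH_ge_CL) (C.task i).T_pos.le)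
            (by linarith)
        rw [sub_div] at h3 ⊢
        rcases max_cases 0 ((C.task i).dbf t tI - (C.task i).dbf t tE) with hm | hm <;>
          nlinarith
      · linarith
    rw [Finset.sum_add_distrib, Finset.sum_add_distrib, Finset.sum_add_distrib,
      Finset.sum_add_distrib, ← hsub, ← hsub, ← Finset.sum_mul, ← Finset.sum_mul] at hsum
    unfold UHL UHH
    linarith
  unfold dbf demandConst
  linarith

/-- Up to `tMax` the test applies. Beyond it, write `t = tI + (tE - tI) + (t - tE)`: the rate gaps
on these pieces are the three entries of `slack`, so the spare supply is at least `slack * t`, which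
exceeds both constants together. -/
theorem dbf_le_supply {I : MCPR}
    (htest : ∀ t : ℝ, 0 ≤ t → (t : WithTop ℝ) ≤ C.tMax I →
      ∀ tE : ℝ, 0 ≤ tE → tE ≤ t → ∀ tI : ℝ, 0 ≤ tI → tI ≤ tE →
        C.dbf t tE tI ≤ I.sbf tE t)
    {t tE tI S : ℝ} (hI0 : 0 ≤ tI) (hIE : tI ≤ tE) (hE : tE ≤ t) (hS : 0 ≤ S)
    (h : Run.SupplyShape I tE t S) : C.dbf t tE tI ≤ S := by
  have h0 : 0 ≤ tE := hI0.trans hIE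
  by_cases hmax : (t : WithTop ℝ) ≤ C.tMax I
  · exact (htest t (h0.trans hE) hmax tE h0 hE tI hI0 hIE).trans
      (I.sbf_le_of_supplyShape h0 hE hS h)
  · refine (C.dbf_le_linear hIE hE).trans (le_trans ?_ (I.supplyShape_linear h0 hE h))
    unfold tMax at hmax
    split_ifs at hmax with hpos
    · rw [WithTop.coe_le_coe, not_le, div_lt_iff₀ hpos] at hmax
      have s1 : C.slack I ≤ I.CH / I.T - C.UHH := min_le_left _ _
      have s2 : C.slack I ≤ I.CL / I.T - (C.UHL + C.extraU) :=
        (min_le_right _ _).trans (min_le_left _ _)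
      have s3 : C.slack I ≤ I.CL / I.T - (C.ULL + C.UHL) :=
        (min_le_right _ _).trans (min_le_right _ _)
      have e1 := mul_le_mul_of_nonneg_right s1 (sub_nonneg.2 hE)
      have e2 := mul_le_mul_of_nonneg_right s2 (sub_nonneg.2 hIE)
      have e3 := mul_le_mul_of_nonneg_right s3 hI0
      nlinarith
    · exact absurd le_top hmax

end Component

/-! ### Execution and mode switches in a run -/

namespace Run

variable {ι : Type*} (R : Run ι)

theorem executed_mono (i : ι) (k : ℕ) {s s' : ℝ} (h : s ≤ s') :
    R.executed i k s ≤ R.executed i k s' :=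
  measureReal_mono (inter_subset_inter_right _ (Ico_subset_Ico_right h))
    (volume_inter_Ico_ne_top _ _ _)

theorem executed_le_add (i : ι) (k : ℕ) (s s' : ℝ) :
    R.executed i k s' ≤ R.executed i k s
      + volume.real ({u | R.exec u = some (i, k)} ∩ Ico s s') := by
  refine (measureReal_mono (?_ : _ ⊆ ({u | R.exec u = some (i, k)} ∩ Ico (R.release i k) s) ∪
    ({u | R.exec u = some (i, k)} ∩ Ico s s')) ?_).trans (measureReal_union_le _ _)
  · rintro u ⟨hu, h1, h2⟩
    rcases lt_or_ge u s with hs | hs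
    · exact Or.inl ⟨hu, h1, hs⟩
    · exact Or.inr ⟨hu, hs, h2⟩
  · exact measure_union_ne_top (volume_inter_Ico_ne_top _ _ _) (volume_inter_Ico_ne_top _ _ _)

theorem executed_le_add_sub (i : ι) (k : ℕ) {s s' : ℝ} (h : s ≤ s') :
    R.executed i k s' ≤ R.executed i k s + (s' - s) := by
  refine (R.executed_le_add i k s s').trans (add_le_add_right ?_ _)
  have : volume.real (Ico s s') = s' - s := by simp [h]
  rw [← this]
  exact measureReal_mono inter_subset_right measure_Ico_lt_top.ne

theorem continuous_executed (i : ι) (k : ℕ) : Continuous (R.executed i k) := by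
  refine LipschitzWith.continuous (K := 1) (LipschitzWith.of_le_add fun x y => ?_)
  rcases le_total x y with h | h
  · have := R.executed_mono i k h
    have := dist_nonneg (x := x) (y := y)
    linarith
  · rw [Real.dist_eq, abs_of_nonneg (by linarith)]
    exact R.executed_le_add_sub i k h

theorem executed_of_le_release (i : ι) (k : ℕ) {s : ℝ} (h : s ≤ R.release i k) :
    R.executed i k s = 0 := by
  unfold executed
  rw [Ico_eq_empty (not_lt.2 h)]
  simp

/-- A job that executes only while it has received at most `c` never receives more than `c`. -/
theorem executed_le_of_forall {i : ι} {k : ℕ} {s c : ℝ} (hc : 0 ≤ c)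
    (h : ∀ u < s, R.exec u = some (i, k) → R.executed i k u ≤ c) : R.executed i k s ≤ c := by
  by_contra! hs
  set r := R.release i k
  have hrs : r ≤ s := by
    by_contra! hlt
    rw [R.executed_of_le_release i k hlt.le] at hs
    linarith
  set A := {x | x ∈ Icc r s ∧ R.executed i k x ≤ c} with hA
  have hAr : r ∈ A := ⟨⟨le_rfl, hrs⟩, by rw [R.executed_of_le_release i k le_rfl]; exact hc⟩
  have hAc : IsClosed A := by
    have : A = Icc r s ∩ {x | R.executed i k x ≤ c} := by ext; simp [hA]
    rw [this]
    exact isClosed_Icc.inter (isClosed_le (R.continuous_executed i k) continuous_const)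
  have hAb : BddAbove A := ⟨s, fun x hx => hx.1.2⟩
  have hv := hAc.csSup_mem ⟨r, hAr⟩ hAb
  set v := sSup A
  -- After the last instant `v` with at most `c` received, the job executes at most at `v` itself.
  have hzero : volume.real ({u | R.exec u = some (i, k)} ∩ Ico v s) = 0 := by
    have hsub : {u | R.exec u = some (i, k)} ∩ Ico v s ⊆ {v} := by
      rintro u ⟨hu, h1, h2⟩
      have hu' := h u h2 hu
      exact le_antisymm (le_csSup hAb ⟨⟨hv.1.1.trans h1, h2.le⟩, hu'⟩) h1
    have hm : volume ({u | R.exec u = some (i, k)} ∩ Ico v s) = 0 :=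
      measure_mono_null hsub (by simp)
    simp [measureReal_def, hm]
  have := R.executed_le_add i k v s
  have := hv.2
  linarith

end Run

namespace Run

variable {ι : Type*} [Fintype ι] {C : Component ι} {R : Run ι}

theorem IsEMS.emsReached_iff {tE : ℝ} (h : R.IsEMS C tE) (s : ℝ) :
    R.emsReached C s ↔ tE ≤ s := by
  classical
  refine ⟨fun hs => h.2 hs, fun hs => lt_of_lt_of_le h.1 (Finset.card_le_card ?_)⟩
  intro i hi
  simp only [Finset.mem_filter] at hi ⊢
  exact ⟨hi.1, hi.2.trans (WithTop.coe_le_coe.2 hs)⟩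

/-- The entry instant is `min (switch i) tE`, a real number because the external switch occurs. -/
theorem IsEMS.exists_entry {tE : ℝ} (h : R.IsEMS C tE) :
    ∃ e : ι → ℝ, (∀ i, e i ≤ tE) ∧ (∀ i, (e i : WithTop ℝ) ≤ R.switch i) ∧
      (∀ i s, R.inHC C i s ↔ (C.task i).level = Level.HC ∧ e i ≤ s) ∧
      (∀ i, e i < tE → R.switch i = e i) := by
  have hex : ∀ i, ∃ x : ℝ, (x : WithTop ℝ) = min (R.switch i) tE := by
    intro i
    have : min (R.switch i) (tE : WithTop ℝ) ≠ ⊤ := by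
      intro hc
      have := min_le_right (R.switch i) (tE : WithTop ℝ)
      rw [hc] at this
      exact WithTop.coe_ne_top (top_le_iff.1 this)
    exact ⟨_, WithTop.coe_untop _ this⟩
  choose e he using hex
  refine ⟨e, fun i => ?_, fun i => ?_, fun i s => ?_, fun i hi => ?_⟩
  · exact WithTop.coe_le_coe.1 ((he i).le.trans (min_le_right _ _))
  · exact (he i).le.trans (min_le_left _ _)
  · unfold inHC
    rw [h.emsReached_iff]
    refine and_congr_right fun _ => ?_
    have : e i ≤ s ↔ (e i : WithTop ℝ) ≤ s := WithTop.coe_le_coe.symm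
    rw [this, he i, min_le_iff, WithTop.coe_le_coe]
  · rcases min_cases (R.switch i) (tE : WithTop ℝ) with hm | hm
    · rw [he i, hm.1]
    · have := he i
      rw [hm.1] at this
      exact absurd (WithTop.coe_injective this) hi.ne

/-- Fewer tasks than tolerated switch strictly before the external mode switch. -/
theorem IsEMS.card_le {tE : ℝ} (h : R.IsEMS C tE) {G : Finset ι} (hG : G ⊆ C.hcTasks)
    {e : ι → ℝ} (he : ∀ i ∈ G, e i < tE ∧ R.switch i = e i) : G.card ≤ C.TL := by
  classical
  rcases G.eq_empty_or_nonempty with rfl | hne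
  · simp
  by_contra! hc
  -- At the latest of these switches more than `TL` tasks have switched, which is an external switch
  -- before `tE`.
  obtain ⟨j, hj, hmax⟩ := G.exists_max_image e hne
  have : R.emsReached C (e j) := by
    refine lt_of_lt_of_le hc (Finset.card_le_card fun i hi => ?_)
    simp only [Finset.mem_filter]
    exact ⟨hG hi, by rw [(he i hi).2]; exact WithTop.coe_le_coe.2 (hmax i hi)⟩
  exact absurd ((h.emsReached_iff _).1 this) (not_le.2 (he j hj).1)

theorem IsEMS.exists_dropTime {tE : ℝ} (h : R.IsEMS C tE) :
    ∃ d : ℝ, R.dropTime C = d ∧ d ≤ tE := by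
  classical
  have hpos : 0 < (C.hcTasks.filter fun i => R.switch i ≤ (tE : WithTop ℝ)).card :=
    lt_of_le_of_lt (Nat.zero_le _) h.1
  obtain ⟨i, hi⟩ := Finset.card_pos.1 hpos
  obtain ⟨hi1, hi2⟩ := Finset.mem_filter.1 hi
  have hle : R.dropTime C ≤ (tE : WithTop ℝ) :=
    (min_le_left _ _).trans ((Finset.inf_le hi1).trans hi2)
  have hne : R.dropTime C ≠ ⊤ := fun hc => by
    rw [hc] at hle
    exact WithTop.coe_ne_top (top_le_iff.1 hle)
  refine ⟨(R.dropTime C).untop hne, (WithTop.coe_untop _ hne).symm, ?_⟩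
  rw [← WithTop.coe_le_coe, WithTop.coe_untop]
  exact hle

theorem dropTime_le_switch {i : ι} (hi : i ∈ C.hcTasks) : R.dropTime C ≤ R.switch i :=
  (min_le_left _ _).trans (Finset.inf_le hi)

/-- This allows tracing a job back in time: a deadline not after `b` now was not after `b` at any
earlier instant. -/
theorem currentDeadline_mono (i : ι) (k : ℕ) {s s' : ℝ} (h : s ≤ s') :
    R.currentDeadline C i k s ≤ R.currentDeadline C i k s' := by
  have hinHC : R.inHC C i s → R.inHC C i s' := by
    classical
    rintro ⟨h1, h2⟩
    refine ⟨h1, h2.imp (fun h2 => h2.trans (WithTop.coe_le_coe.2 h)) fun h2 =>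
      lt_of_lt_of_le h2 (Finset.card_le_card fun j hj => ?_)⟩
    simp only [Finset.mem_filter] at hj ⊢
    exact ⟨hj.1, hj.2.trans (WithTop.coe_le_coe.2 h)⟩
  have := (C.task i).DL_le_D
  unfold currentDeadline
  split_ifs with h1 h2
  · exact le_rfl
  · exact absurd (hinHC h1) h2
  · linarith
  · exact le_rfl

theorem add_DL_le_currentDeadline (i : ι) (k : ℕ) (s : ℝ) :
    R.release i k + (C.task i).DL ≤ R.currentDeadline C i k s := by
  have := (C.task i).DL_le_D
  unfold currentDeadline
  split_ifs <;> linarith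

theorem Pending.of_le {i : ι} {k : ℕ} {s s' : ℝ} (h : R.Pending C i k s') (hs : s ≤ s')
    (hr : R.release i k ≤ s) : R.Pending C i k s :=
  ⟨hr, (R.executed_mono i k hs).trans_lt h.2.1,
    fun hl => (WithTop.coe_le_coe.2 hs).trans_lt (h.2.2 hl)⟩

namespace IsRunOf

variable (hR : R.IsRunOf C)
include hR

theorem separated (i : ι) : Separated (C.task i).T (R.release i) := by
  intro k l hkl
  induction l, hkl using Nat.le_induction with
  | base => have := hR.separation i k; push_cast; linarith
  | succ l _ ih => have := hR.separation i l; push_cast; linarith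

theorem release_ge (i : ι) (k : ℕ) : k * (C.task i).T ≤ R.release i k := by
  have h0 := hR.release_nonneg i
  rcases Nat.eq_zero_or_pos k with rfl | hk
  · simpa using h0
  · have := hR.separated i 0 k hk
    push_cast at this
    linarith

theorem release_nonneg' (i : ι) (k : ℕ) : 0 ≤ R.release i k :=
  (mul_nonneg (Nat.cast_nonneg k) (C.task i).T_pos.le).trans (hR.release_ge i k)

theorem exists_bound (b : ℝ) : ∃ N : ℕ, ∀ i k, R.release i k < b → k < N := by
  have h : ∀ i, ∃ n : ℕ, b ≤ n * (C.task i).T := by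
    intro i
    obtain ⟨n, hn⟩ := exists_nat_ge (b / (C.task i).T)
    exact ⟨n, (div_le_iff₀ (C.task i).T_pos).1 hn⟩
  choose n hn using h
  refine ⟨Finset.univ.sup n, fun i k hk => lt_of_lt_of_le ?_ (Finset.le_sup (Finset.mem_univ i))⟩
  have h1 := hR.release_ge i k
  have h2 : (k : ℝ) * (C.task i).T < n i * (C.task i).T := by linarith [hn i]
  exact_mod_cast lt_of_mul_lt_mul_right h2 (C.task i).T_pos.le

theorem executed_le_demand (i : ι) (k : ℕ) (s : ℝ) : R.executed i k s ≤ R.demand i k :=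
  R.executed_le_of_forall (hR.demand_nonneg i k) fun u _ hu =>
    (hR.exec_pending u i k hu).2.1.le

/-- A task executes its jobs for at most `CL` before it switches to `HC` mode. -/
theorem executed_le_CL {e : ℝ} {i : ι} (hi : (C.task i).level = Level.HC)
    (he : (e : WithTop ℝ) ≤ R.switch i) (k : ℕ) {s : ℝ} (hs : s ≤ e) :
    R.executed i k s ≤ (C.task i).CL := by
  refine R.executed_le_of_forall (C.task i).CL_pos.le fun u hu hex => ?_
  by_contra! hc
  have h1 := (hR.exec_pending u i k hex).2.1
  have h2 := he.trans (hR.switch_le i hi k u (hc.trans h1) hc.le)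
  have := WithTop.coe_le_coe.1 h2
  linarith

/-- A job that has received the smaller of its demand and `CL` before the switch of its task does
not need more than `CL`. -/
theorem demand_le_CL {e : ℝ} {i : ι} (hi : (C.task i).level = Level.HC)
    (he : (e : WithTop ℝ) ≤ R.switch i) {k : ℕ} {s : ℝ} (hs : s < e)
    (h : min (R.demand i k) (C.task i).CL ≤ R.executed i k s) :
    R.demand i k ≤ (C.task i).CL := by
  by_contra! hc
  rw [min_eq_right hc.le] at h
  have := WithTop.coe_le_coe.1 (he.trans (hR.switch_le i hi k s hc h))
  linarith

end IsRunOf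

/-! ### Busy windows -/

/-- At instant `u`, some job competes for the processor with a deadline not after `b`. -/
def Busy (C : Component ι) (R : Run ι) (b u : ℝ) : Prop :=
  ∃ i k, R.Pending C i k u ∧ R.currentDeadline C i k u ≤ b

/-- The instants strictly between `a` and `b` at which the `k`-th job of task `i` executes with a
deadline not after `b`. -/
def execWithin (C : Component ι) (R : Run ι) (a b : ℝ) (i : ι) (k : ℕ) : Set ℝ :=
  {u | a < u ∧ u < b ∧ R.exec u = some (i, k) ∧ R.currentDeadline C i k u ≤ b}

theorem execWithin_subset (a b : ℝ) (i : ι) (k : ℕ) : execWithin C R a b i k ⊆ Ico a b :=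
  fun _ hu => ⟨hu.1.le, hu.2.1⟩

theorem IsRunOf.volume_execWithin_le_executed (hR : R.IsRunOf C) {a b s : ℝ} {i : ι} {k : ℕ}
    (h : ∀ u ∈ execWithin C R a b i k, u < s) :
    volume.real (execWithin C R a b i k) ≤ R.executed i k s :=
  measureReal_mono (fun u hu => ⟨hu.2.2.1, (hR.exec_pending u i k hu.2.2.1).1, h u hu⟩)
    (volume_inter_Ico_ne_top _ _ _)

theorem IsRunOf.volume_execWithin_le_max (hR : R.IsRunOf C) {a b s : ℝ} {i : ι} {k : ℕ}
    (h : ∀ u ∈ execWithin C R a b i k, u < s) :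
    volume.real (execWithin C R a b i k) ≤ max 0 (s - R.release i k) := by
  have : volume.real (Ico (R.release i k) s) = max 0 (s - R.release i k) := by
    rcases le_total (R.release i k) s with hle | hle
    · simp [hle]
    · rw [Ico_eq_empty (not_lt.2 hle), max_eq_left (by linarith)]; simp
  rw [← this]
  exact measureReal_mono (fun u hu => ⟨(hR.exec_pending u i k hu.2.2.1).1, h u hu⟩)
    measure_Ico_lt_top.ne

/-- From a busy interval up to `b` one obtains an instant `a` from which on all supply is used by
jobs released since, with deadlines not after `b`. -/
theorem IsRunOf.exists_busy_start (hR : R.IsRunOf C) {b r : ℝ} (hr0 : 0 ≤ r) (hrb : r < b)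
    (hbusy : ∀ u, r ≤ u → u < b → Busy C R b u) :
    ∃ a, a ≤ r ∧ ∀ u ∈ R.supply, a < u → u < b →
      ∃ i k, u ∈ execWithin C R a b i k ∧ a ≤ R.release i k := by
  -- The infimum of the busy starts need not be one itself, hence the strict inequality `a < u`
  -- throughout.
  set S := {s | 0 ≤ s ∧ s ≤ b ∧ ∀ u, s ≤ u → u < b → Busy C R b u} with hS
  have hSb : BddBelow S := ⟨0, fun s hs => hs.1⟩
  have hrS : r ∈ S := ⟨hr0, hrb.le, hbusy⟩
  refine ⟨sInf S, csInf_le hSb hrS, fun u hu hau hub => ?_⟩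
  obtain ⟨s, hs, hsu⟩ := exists_lt_of_csInf_lt ⟨r, hrS⟩ hau
  obtain ⟨i', k', hp', hd'⟩ := hs.2.2 u hsu.le hub
  obtain ⟨⟨i, k⟩, hex⟩ := Option.ne_none_iff_exists'.1 (hR.work_conserving u hu ⟨i', k', hp'⟩)
  have hp := hR.exec_pending u i k hex
  have hd := (hR.exec_edf u i k hex i' k' hp').trans hd'
  refine ⟨i, k, ⟨hau, hub, hex, hd⟩, ?_⟩
  by_contra! hlt
  -- A job executing at `u` but released before `a` would have kept the system busy since its
  -- release, so the busy period would start earlier.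
  have hmem : R.release i k ∈ S := by
    refine ⟨hR.release_nonneg' i k, (hlt.le.trans hau.le).trans hub.le, fun v hv1 hv2 => ?_⟩
    rcases le_or_gt v u with h | h
    · exact ⟨i, k, hp.of_le h hv1, (currentDeadline_mono i k h).trans hd⟩
    · exact hs.2.2 v (hsu.le.trans h.le) hv2
  exact absurd (csInf_le hSb hmem) (not_le.2 hlt)

theorem IsRunOf.supplied_le_sum (hR : R.IsRunOf C) {a b : ℝ} {N : ℕ}
    (hN : ∀ i k, R.release i k < b → k < N)
    (h : ∀ u ∈ R.supply, a < u → u < b →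
      ∃ i k, u ∈ execWithin C R a b i k ∧ a ≤ R.release i k) :
    R.supplied a b ≤ ∑ i, ∑ k ∈ Finset.range N with a ≤ R.release i k,
      volume.real (execWithin C R a b i k) := by
  have hsub : R.supply ∩ Ico a b ⊆ {a} ∪ ⋃ i ∈ (Finset.univ : Finset ι),
      ⋃ k ∈ (Finset.range N).filter (fun k => a ≤ R.release i k), execWithin C R a b i k := by
    rintro u ⟨hu, h1, h2⟩
    rcases h1.eq_or_lt with he | hlt
    · exact Or.inl he.symm
    · obtain ⟨i, k, hx, hrel⟩ := h u hu hlt h2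
      refine Or.inr (mem_biUnion (Finset.mem_univ i) (mem_biUnion ?_ hx))
      have := (hR.exec_pending u i k hx.2.2.1).1
      simpa using ⟨hN i k (by linarith), hrel⟩
  have hsub' : (⋃ i ∈ (Finset.univ : Finset ι),
      ⋃ k ∈ (Finset.range N).filter (fun k => a ≤ R.release i k), execWithin C R a b i k) ⊆
      Ico a b := by
    simp only [iUnion_subset_iff]
    exact fun i _ k _ => execWithin_subset a b i k
  have hfin := ((measure_mono (μ := volume) hsub').trans_lt measure_Ico_lt_top).ne
  refine (measureReal_mono hsub (measure_union_ne_top (by simp) hfin)).trans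
    ((measureReal_union_le _ _).trans ?_)
  have : volume.real ({a} : Set ℝ) = 0 := by simp [measureReal_def]
  rw [this, zero_add]
  refine (measureReal_biUnion_finset_le _ _).trans (Finset.sum_le_sum fun i _ => ?_)
  exact measureReal_biUnion_finset_le _ _

end Run

/-! ### The deficit argument -/

/-- The instant `x`, relative to the start of the window `[a, b)` and restricted to it. -/
def clip (a b x : ℝ) : ℝ := max 0 (min (x - a) (b - a))

section clip

variable {a b x y : ℝ}

theorem clip_nonneg (a b x : ℝ) : 0 ≤ clip a b x := le_max_left _ _

theorem clip_le (hab : a ≤ b) (x : ℝ) : clip a b x ≤ b - a :=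
  max_le (by linarith) (min_le_right _ _)

theorem clip_mono (a b : ℝ) (h : x ≤ y) : clip a b x ≤ clip a b y := by
  unfold clip
  gcongr

theorem clip_of_le (hab : a ≤ b) (h : b ≤ x) : clip a b x = b - a := by
  unfold clip
  rw [min_eq_right (by linarith), max_eq_right (by linarith)]

theorem lt_of_lt_clip (h0 : 0 ≤ y) (h : y < clip a b x) : y + a < x ∧ y + a < b := by
  rcases lt_max_iff.1 h with h | h
  · linarith
  · obtain ⟨h1, h2⟩ := lt_min_iff.1 h
    constructor <;> linarith

theorem le_of_le_clip (h0 : 0 < y) (h : y ≤ clip a b x) : y + a ≤ x ∧ y + a ≤ b := by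
  rcases le_max_iff.1 h with h | h
  · linarith
  · obtain ⟨h1, h2⟩ := le_min_iff.1 h
    constructor <;> linarith

theorem min_sub_le_clip (a b x : ℝ) : min x b - a ≤ clip a b x := by
  rw [← min_sub_sub_right]
  exact le_max_right _ _

theorem lt_of_clip_ne (hxy : x ≤ y) (h : clip a b x ≠ clip a b y) : x < y :=
  hxy.lt_of_ne fun he => h (by rw [he])

end clip

namespace Run

variable {ι : Type*} [Fintype ι] {C : Component ι} {R : Run ι}

/-- From its entry on, the task is scheduled by `D`, and this deadline lies beyond `b`. -/
theorem execWithin_lt_entry {e : ι → ℝ}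
    (hin : ∀ i s, R.inHC C i s ↔ (C.task i).level = Level.HC ∧ e i ≤ s) {a b : ℝ} {i : ι} {k : ℕ}
    (hi : (C.task i).level = Level.HC) (h : b < R.release i k + (C.task i).D) :
    ∀ u ∈ execWithin C R a b i k, u < min (e i) b := by
  intro u hu
  refine lt_min ?_ hu.2.1
  by_contra! hc
  have := hu.2.2.2
  unfold currentDeadline at this
  rw [if_pos ((hin i u).2 ⟨hi, hc⟩)] at this
  linarith

theorem volume_execWithin_of_lt {a b : ℝ} {i : ι} {k : ℕ}
    (h : b < R.release i k + (C.task i).DL) : volume.real (execWithin C R a b i k) = 0 := by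
  have : execWithin C R a b i k = ∅ := by
    refine eq_empty_of_forall_notMem fun u hu => ?_
    have := add_DL_le_currentDeadline (C := C) (R := R) i k u
    have := hu.2.2.2
    linarith
  rw [this]
  simp

/-- The `CL` clauses all rest on one fact: more than `CL` can be executed only after the switch. A
job that met a tightened or full deadline before the switch therefore needs no more than `CL`. -/
theorem IsRunOf.jobBound_execWithin (hR : R.IsRunOf C) {e : ι → ℝ}
    (hsw : ∀ i, (e i : WithTop ℝ) ≤ R.switch i)
    (hin : ∀ i s, R.inHC C i s ↔ (C.task i).level = Level.HC ∧ e i ≤ s) {a b : ℝ} (hab : a < b)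
    {i : ι} {k : ℕ} (hi : (C.task i).level = Level.HC)
    (htight : R.release i k + (C.task i).DL < b → R.release i k + (C.task i).DL < e i →
      min (R.demand i k) (C.task i).CL ≤ R.executed i k (R.release i k + (C.task i).DL))
    (hdue : R.release i k + (C.task i).D ≤ b - (C.task i).D →
      R.demand i k ≤ R.executed i k (R.release i k + (C.task i).D))
    (hk : a ≤ R.release i k) :
    (C.task i).JobBound (b - a) (clip a b (e i)) (fun k => R.release i k - a)
      (fun k => volume.real (execWithin C R a b i k)) k := by
  have hexb := hR.volume_execWithin_le_executed (a := a) (b := b) (s := b) (i := i) (k := k)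
    fun u hu => hu.2.1
  have hdem := hexb.trans (hR.executed_le_demand i k b)
  have hDL := (C.task i).DL_pos
  have hD := (C.task i).D_pos
  constructor
  · intro h
    exact (volume_execWithin_of_lt (by linarith)).le
  · exact hdem.trans (hR.demand_le i k)
  · intro h
    have hlt := execWithin_lt_entry (a := a) hin hi
      (show b < R.release i k + (C.task i).D by linarith)
    refine ⟨(hR.volume_execWithin_le_executed hlt).trans
      (hR.executed_le_CL hi (hsw i) k (min_le_left _ _)),
      (hR.volume_execWithin_le_max hlt).trans (max_le_max_left 0 ?_)⟩
    have := min_sub_le_clip a b (e i)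
    linarith
  · intro h
    obtain ⟨h1, h2⟩ := lt_of_lt_clip (by linarith) h
    have h3 := htight (by linarith) (by linarith)
    exact hdem.trans (hR.demand_le_CL hi (hsw i) (by linarith) h3)
  · intro h h'
    obtain ⟨h1, h2⟩ := le_of_le_clip (by linarith) h
    exact hdem.trans ((hdue (by linarith)).trans (hR.executed_le_CL hi (hsw i) k (by linarith)))
  · intro h
    obtain ⟨h1, h2⟩ := le_of_le_clip (by linarith) h.ge
    exact hexb.trans (hR.executed_le_CL hi (hsw i) k (by linarith))

/-- If demand never exceeds supply, no job can be the first to fall short in a window ending at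
`b`. -/
theorem IsRunOf.no_deficit (hR : R.IsRunOf C) {tE : ℝ} (hE : R.IsEMS C tE) {e : ι → ℝ}
    (hetE : ∀ i, e i ≤ tE) (hsw : ∀ i, (e i : WithTop ℝ) ≤ R.switch i)
    (hin : ∀ i s, R.inHC C i s ↔ (C.task i).level = Level.HC ∧ e i ≤ s)
    (hswe : ∀ i, e i < tE → R.switch i = e i)
    (hdem : ∀ a b tI, a < b → 0 ≤ tI → tI ≤ clip a b tE →
      C.dbf (b - a) (clip a b tE) tI ≤ R.supplied a b)
    {b : ℝ}
    (htight : ∀ i k, (C.task i).level = Level.HC → R.release i k + (C.task i).DL < b →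
      R.release i k + (C.task i).DL < e i →
      min (R.demand i k) (C.task i).CL ≤ R.executed i k (R.release i k + (C.task i).DL))
    (hdue : ∀ i k, (C.task i).level = Level.HC →
      R.release i k + (C.task i).D ≤ b - (C.task i).D →
      R.demand i k ≤ R.executed i k (R.release i k + (C.task i).D))
    {i₀ : ι} {k₀ : ℕ} {y : ℝ} (hy : R.executed i₀ k₀ b < y) (hrb : R.release i₀ k₀ < b)
    (hbusy : ∀ u, R.release i₀ k₀ ≤ u → u < b →
      R.Pending C i₀ k₀ u ∧ R.currentDeadline C i₀ k₀ u ≤ b)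
    (hLC : (C.task i₀).level = Level.LC → y ≤ (C.task i₀).CL ∧
      R.release i₀ k₀ + (C.task i₀).D ≤ b ∧ (b : WithTop ℝ) ≤ R.dropTime C)
    (hHC : (C.task i₀).level = Level.HC → y ≤ (C.task i₀).CH ∧
      R.release i₀ k₀ + (C.task i₀).DL ≤ b ∧
      (b < R.release i₀ k₀ + (C.task i₀).D → y ≤ (C.task i₀).CL ∧ b ≤ e i₀) ∧
      (R.release i₀ k₀ + (C.task i₀).DL < e i₀ → y ≤ (C.task i₀).CL) ∧
      (R.release i₀ k₀ + (C.task i₀).D ≤ b - (C.task i₀).D → y ≤ (C.task i₀).CL) ∧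
      (b ≤ e i₀ → y ≤ (C.task i₀).CL)) : False := by
  classical
  obtain ⟨a, har, ha⟩ := hR.exists_busy_start (hR.release_nonneg' i₀ k₀) hrb
    fun u h1 h2 => ⟨i₀, k₀, hbusy u h1 h2⟩
  have hab : a < b := har.trans_lt hrb
  obtain ⟨N, hN⟩ := hR.exists_bound b
  have hsup := hR.supplied_le_sum hN ha
  obtain ⟨d, hd, hdtE⟩ := hE.exists_dropTime
  -- The deficient job is credited with its full requirement `y` instead of what it received. This
  -- makes the total strictly exceed the supply while each task still respects its demand bound.
  set Y : ι → ℕ → ℝ := fun i k =>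
    if i = i₀ ∧ k = k₀ then y else volume.real (execWithin C R a b i k) with hY
  have hX₀ : volume.real (execWithin C R a b i₀ k₀) < y :=
    (hR.volume_execWithin_le_executed fun u hu => hu.2.1).trans_lt hy
  have hXY : ∀ i k, volume.real (execWithin C R a b i k) ≤ Y i k := by
    intro i k
    simp only [hY]
    split_ifs with h
    · rw [h.1, h.2]; exact hX₀.le
    · exact le_rfl
  have hlt : ∑ i, ∑ k ∈ Finset.range N with a ≤ R.release i k,
      volume.real (execWithin C R a b i k) <
      ∑ i, ∑ k ∈ Finset.range N with a ≤ R.release i k, Y i k := by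
    refine Finset.sum_lt_sum (fun i _ => Finset.sum_le_sum fun k _ => hXY i k)
      ⟨i₀, Finset.mem_univ _, Finset.sum_lt_sum (fun k _ => hXY i₀ k) ⟨k₀, ?_, ?_⟩⟩
    · simpa using ⟨hN i₀ k₀ hrb, har⟩
    · simpa [hY] using hX₀
  have hsep : ∀ i, Separated (C.task i).T fun k => R.release i k - a := by
    intro i k l hkl
    have := hR.separated i k l hkl
    linarith
  have hLCsum : ∀ i ∈ C.lcTasks, ∑ k ∈ Finset.range N with a ≤ R.release i k, Y i k ≤
      (C.task i).dbf (b - a) (clip a b d) := by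
    intro i hi
    have hi := C.mem_lcTasks.1 hi
    have hDL := (C.task i).DL_eq_D_of_LC hi
    have hmem : ∀ k ∈ (Finset.range N).filter (fun k => a ≤ R.release i k), a ≤ R.release i k :=
      fun k hk => (Finset.mem_filter.1 hk).2
    have hXlt : ∀ k, ∀ u ∈ execWithin C R a b i k, u < min d b := by
      intro k u hu
      refine lt_min ?_ hu.2.1
      have := (hR.exec_pending u i k hu.2.2.1).2.2 hi
      rw [hd] at this
      exact WithTop.coe_lt_coe.1 this
    refine (C.task i).sum_le_dbf_LC hi (hsep i) (clip_nonneg _ _ _) (fun k hk => ?_)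
      (fun k hk => ?_) (fun k hk => ?_) (fun k hk h => ?_)
    · linarith [hmem k hk]
    · simp only [hY]
      split_ifs with h
      · obtain ⟨rfl, rfl⟩ := h
        exact (hLC hi).1
      · rw [(C.task i).CL_eq_CH_of_LC hi]
        exact ((hR.volume_execWithin_le_executed (hXlt k)).trans
          (hR.executed_le_demand i k _)).trans (hR.demand_le i k)
    · simp only [hY]
      split_ifs with h
      · obtain ⟨rfl, rfl⟩ := h
        obtain ⟨h1, h2, h3⟩ := hLC hi
        rw [hd] at h3
        rw [clip_of_le hab.le (WithTop.coe_le_coe.1 h3)]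
        refine le_max_of_le_right ?_
        have := (C.task i).CL_le_DL
        linarith
      · refine (hR.volume_execWithin_le_max (hXlt k)).trans (max_le_max_left 0 ?_)
        have := min_sub_le_clip a b d
        linarith
    · simp only [hY]
      split_ifs with h'
      · obtain ⟨rfl, rfl⟩ := h'
        have := (hLC hi).2.1
        linarith
      · exact (volume_execWithin_of_lt (by linarith)).le
  have hHCsum : ∀ i ∈ C.hcTasks, ∀ x, x ≤ e i →
      ∑ k ∈ Finset.range N with a ≤ R.release i k, Y i k ≤
      max ((C.task i).dbf (b - a) (clip a b x)) ((C.task i).dbf (b - a) (clip a b tE)) ∧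
      (clip a b (e i) = clip a b tE →
        ∑ k ∈ Finset.range N with a ≤ R.release i k, Y i k ≤
          (C.task i).dbf (b - a) (clip a b tE)) := by
    intro i hi x hx
    have hi := C.mem_hcTasks.1 hi
    have hmem : ∀ k ∈ (Finset.range N).filter (fun k => a ≤ R.release i k), a ≤ R.release i k :=
      fun k hk => (Finset.mem_filter.1 hk).2
    have hJB : ∀ k ∈ (Finset.range N).filter (fun k => a ≤ R.release i k),
        (C.task i).JobBound (b - a) (clip a b (e i)) (fun k => R.release i k - a) (Y i) k := by
      intro k hk
      have hJ := hR.jobBound_execWithin hsw hin hab hi (htight i k hi) (hdue i k hi) (hmem k hk)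
      by_cases h : i = i₀ ∧ k = k₀
      · have hYy : Y i k = y := by simp only [hY]; rw [if_pos h]
        obtain ⟨rfl, rfl⟩ := h
        obtain ⟨h1, h2, h3, h4, h5, h6⟩ := hHC hi
        have hD := (C.task i).D_pos
        have hDL := (C.task i).DL_pos
        refine ⟨fun h => by linarith, hYy ▸ h1, fun h => ?_, fun h => ?_, fun _ h => ?_,
          fun h => ?_⟩
        · obtain ⟨h7, h8⟩ := h3 (by linarith)
          rw [hYy, clip_of_le hab.le h8]
          refine ⟨h7, le_max_of_le_right ?_⟩
          have := (C.task i).CL_le_DL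
          linarith
        · have := lt_of_lt_clip (by linarith) h
          exact hYy ▸ h4 (by linarith)
        · exact hYy ▸ h5 (by linarith)
        · have := le_of_le_clip (by linarith) h.ge
          exact hYy ▸ h6 (by linarith)
      · have hYX : Y i k = volume.real (execWithin C R a b i k) := by
          simp only [hY]; rw [if_neg h]
        refine ⟨fun h => ?_, ?_, fun h => ?_, fun h => ?_, fun h h' => ?_, fun h => ?_⟩ <;>
          rw [hYX]
        · exact hJ.nonpos_of_lt h
        · exact hJ.le_CH
        · exact hJ.le_of_late h
        · exact hJ.le_of_before h
        · exact hJ.le_of_due h h'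
        · exact hJ.le_of_end h
    refine ⟨(C.task i).sum_le_max_dbf_HC hi (hsep i) (clip_nonneg _ _ _) (clip_mono a b hx)
      (clip_mono a b (hetE i)) (clip_le hab.le _) (fun k hk => by linarith [hmem k hk]) hJB,
      fun heq => ?_⟩
    -- With both ends of the range at the clipped `tE`, the maximum collapses to the single bound
    -- there.
    have := (C.task i).sum_le_max_dbf_HC hi (hsep i) (clip_nonneg _ _ _) heq.ge
      heq.le (clip_le hab.le _) (fun k hk => by linarith [hmem k hk]) hJB
    rwa [max_self] at this
  have hde : ∀ i ∈ C.hcTasks, d ≤ e i := by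
    intro i hi
    by_contra! hc
    have h1 := hswe i (hc.trans_le hdtE)
    have h2 := dropTime_le_switch (R := R) hi
    rw [hd, h1] at h2
    exact absurd (WithTop.coe_le_coe.1 h2) (not_le.2 hc)
  -- Entries that are equal after clipping cannot be told apart in the window; only tasks that truly
  -- enter before `tE` can be charged a difference.
  set G := C.hcTasks.filter fun i => clip a b (e i) ≠ clip a b tE with hG
  have hGcard : G.card ≤ C.TL := by
    refine hE.card_le (Finset.filter_subset _ _) (e := e) fun i hi => ?_
    have := lt_of_clip_ne (hetE i) (Finset.mem_filter.1 hi).2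
    exact ⟨this, hswe i this⟩
  have htop := C.sum_le_topSum (f := fun i => max 0 ((C.task i).dbf (b - a) (clip a b d) -
    (C.task i).dbf (b - a) (clip a b tE))) (Finset.filter_subset _ _) hGcard
  have hHCtot : ∑ i ∈ C.hcTasks, ∑ k ∈ Finset.range N with a ≤ R.release i k, Y i k ≤
      ∑ i ∈ C.hcTasks, ((C.task i).dbf (b - a) (clip a b tE) +
        if clip a b (e i) ≠ clip a b tE then max 0 ((C.task i).dbf (b - a) (clip a b d) -
          (C.task i).dbf (b - a) (clip a b tE)) else 0) := by
    refine Finset.sum_le_sum fun i hi => ?_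
    obtain ⟨h1, h2⟩ := hHCsum i hi d (hde i hi)
    split_ifs with h
    · refine h1.trans (le_of_eq ?_)
      rw [← max_add_add_left, add_zero, add_sub_cancel, max_comm]
    · push Not at h
      linarith [h2 h]
  rw [Finset.sum_add_distrib, ← Finset.sum_filter] at hHCtot
  have hLCtot := Finset.sum_le_sum hLCsum
  have hfin := hdem a b (clip a b d) hab (clip_nonneg _ _ _) (clip_mono a b hdtE)
  rw [← C.sum_hcTasks_add_sum_lcTasks] at hlt
  rw [← C.sum_hcTasks_add_sum_lcTasks (fun i => ∑ k ∈ Finset.range N with a ≤ R.release i k,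
    Y i k)] at hlt
  rw [← C.sum_hcTasks_add_sum_lcTasks] at hsup
  unfold Component.dbf at hfin
  linarith

end Run

/-! ### The first missed deadline -/

namespace Run

variable {ι : Type*} [Fintype ι] {C : Component ι} {R : Run ι}

/-- Some job misses a required deadline at `t`, when task `i` enters `HC` mode at `e i`. -/
def MissAt (C : Component ι) (R : Run ι) (e : ι → ℝ) (t : ℝ) : Prop :=
  ∃ i k,
    ((C.task i).level = Level.LC ∧ R.release i k + (C.task i).D = t ∧
      (t : WithTop ℝ) ≤ R.dropTime C ∧ R.executed i k t < R.demand i k) ∨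
    ((C.task i).level = Level.HC ∧ R.release i k + (C.task i).DL = t ∧ t ≤ e i ∧
      R.executed i k t < min (R.demand i k) (C.task i).CL) ∨
    ((C.task i).level = Level.HC ∧ R.release i k + (C.task i).D = t ∧
      R.executed i k t < R.demand i k)

theorem meetsDeadlines_of_forall_not_missAt {e : ι → ℝ}
    (hin : ∀ i s, R.inHC C i s ↔ (C.task i).level = Level.HC ∧ e i ≤ s)
    (h : ∀ t, ¬ MissAt C R e t) : R.MeetsDeadlines C where
  lc i k hi hd := by
    by_contra! hc
    exact h _ ⟨i, k, Or.inl ⟨hi, rfl, hd, hc⟩⟩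
  hc i k hi := by
    by_contra! hc
    exact h _ ⟨i, k, Or.inr (Or.inr ⟨hi, rfl, hc⟩)⟩
  hc_tightened i k hi hs := by
    by_contra! hc
    refine h _ ⟨i, k, Or.inr (Or.inl ⟨hi, rfl, ?_, hc⟩)⟩
    by_contra! hlt
    exact hs _ hlt ((hin i _).2 ⟨hi, le_rfl⟩)

/-- Only finitely many deadlines lie up to `t₁`, because releases are separated. -/
theorem IsRunOf.exists_first_miss (hR : R.IsRunOf C) {e : ι → ℝ} {t₁ : ℝ}
    (h : MissAt C R e t₁) : ∃ t, MissAt C R e t ∧ ∀ s < t, ¬ MissAt C R e s := by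
  obtain ⟨N, hN⟩ := hR.exists_bound t₁
  have hfin : {t | MissAt C R e t ∧ t ≤ t₁}.Finite := by
    refine Set.Finite.subset (s := (fun p : ι × ℕ =>
        R.release p.1 p.2 + (C.task p.1).D) '' (univ ×ˢ Iio N) ∪
      (fun p : ι × ℕ => R.release p.1 p.2 + (C.task p.1).DL) '' (univ ×ˢ Iio N)) ?_ ?_
    · exact ((finite_univ.prod (finite_Iio N)).image _).union
        ((finite_univ.prod (finite_Iio N)).image _)
    · rintro t ⟨⟨i, k, ht⟩, htt⟩
      have hD := (C.task i).D_pos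
      have hDL := (C.task i).DL_pos
      rcases ht with ⟨_, ht, _⟩ | ⟨_, ht, _⟩ | ⟨_, ht, _⟩
      · exact Or.inl ⟨(i, k), ⟨mem_univ _, hN i k (by linarith)⟩, ht⟩
      · exact Or.inr ⟨(i, k), ⟨mem_univ _, hN i k (by linarith)⟩, ht⟩
      · exact Or.inl ⟨(i, k), ⟨mem_univ _, hN i k (by linarith)⟩, ht⟩
  obtain ⟨t, ht, hmin⟩ := Set.exists_min_image _ id hfin ⟨t₁, h, le_rfl⟩
  refine ⟨t, ht.1, fun s hs hm => ?_⟩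
  exact absurd (hmin s ⟨hm, hs.le.trans ht.2⟩) (not_le.2 hs)

open Filter Topology in
/-- Windows that end shortly after `t` contain no further tightened deadline. -/
theorem IsRunOf.exists_window_end (hR : R.IsRunOf C) (t : ℝ) {i₀ : ι} {k₀ : ℕ} {c : ℝ}
    (h : R.executed i₀ k₀ t < c) :
    ∃ b, t < b ∧ R.executed i₀ k₀ b < c ∧ (∀ i, b < t + (C.task i).D) ∧
      ∀ i k, R.release i k + (C.task i).DL < b → R.release i k + (C.task i).DL ≤ t := by
  obtain ⟨N, hN⟩ := hR.exists_bound (t + 1)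
  have hlt : ∀ x, t < x → ∀ᶠ b in 𝓝[>] t, b < x := fun x hx =>
    (eventually_lt_nhds hx).filter_mono nhdsWithin_le_nhds
  have e1 : ∀ᶠ b in 𝓝[>] t, R.executed i₀ k₀ b < c :=
    ((R.continuous_executed i₀ k₀).continuousAt.eventually (eventually_lt_nhds h)).filter_mono
      nhdsWithin_le_nhds
  have e2 : ∀ᶠ b in 𝓝[>] t, ∀ i, b < t + (C.task i).D :=
    eventually_all.2 fun i => hlt _ (by linarith [(C.task i).D_pos])
  have e3 : ∀ᶠ b in 𝓝[>] t, ∀ i, ∀ k ∈ Finset.range N,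
      t < R.release i k + (C.task i).DL → b < R.release i k + (C.task i).DL := by
    refine eventually_all.2 fun i => (eventually_all_finset _).2 fun k _ => ?_
    by_cases hc : t < R.release i k + (C.task i).DL
    · exact (hlt _ hc).mono fun b hb _ => hb
    · exact Eventually.of_forall fun b hb => absurd hb hc
  have e4 : ∀ᶠ b in 𝓝[>] t, t < b := self_mem_nhdsWithin
  obtain ⟨b, ⟨⟨h1, h2⟩, ⟨h3, h4⟩⟩, h5⟩ := ((e1.and e2).and (e3.and e4)).and
    (hlt (t + 1) (by linarith)) |>.exists
  refine ⟨b, h4, h1, h2, fun i k hb => ?_⟩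
  by_contra! hc
  have hDL := (C.task i).DL_pos
  have := h3 i k (Finset.mem_range.2 (hN i k (by linarith))) hc
  linarith

end Run

theorem schedulableInHCMode_of_dbf_le_sbf {ι : Type*} [Fintype ι] (C : Component ι) (I : MCPR)
    (htest : ∀ t : ℝ, 0 ≤ t → (t : WithTop ℝ) ≤ C.tMax I →
      ∀ tE : ℝ, 0 ≤ tE → tE ≤ t → ∀ tI : ℝ, 0 ≤ tI → tI ≤ tE →
        C.dbf t tE tI ≤ I.sbf tE t) :
    SchedulableInHCMode C I := by
  intro R tE hR hE hS
  obtain ⟨e, hetE, hsw, hin, hswe⟩ := hE.exists_entry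
  have hdem : ∀ a b tI, a < b → 0 ≤ tI → tI ≤ clip a b tE →
      C.dbf (b - a) (clip a b tE) tI ≤ R.supplied a b := fun a b tI hab h0 h1 =>
    C.dbf_le_supply htest h0 h1 (clip_le hab.le _) (R.supplied_nonneg _ _)
      (R.supplyShape_of_suppliedBy hS hab)
  refine Run.meetsDeadlines_of_forall_not_missAt hin fun t₁ ht₁ => ?_
  obtain ⟨t, ⟨i₀, k₀, hmiss⟩, hfirst⟩ := hR.exists_first_miss ht₁
  have htight : ∀ i k, (C.task i).level = Level.HC → R.release i k + (C.task i).DL < t →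
      R.release i k + (C.task i).DL < e i →
      min (R.demand i k) (C.task i).CL ≤ R.executed i k (R.release i k + (C.task i).DL) := by
    intro i k hi h1 h2
    by_contra! hc
    exact hfirst _ h1 ⟨i, k, Or.inr (Or.inl ⟨hi, rfl, h2.le, hc⟩)⟩
  have hdue : ∀ i k, (C.task i).level = Level.HC → R.release i k + (C.task i).D < t →
      R.demand i k ≤ R.executed i k (R.release i k + (C.task i).D) := by
    intro i k hi h1
    by_contra! hc
    exact hfirst _ h1 ⟨i, k, Or.inr (Or.inr ⟨hi, rfl, hc⟩)⟩
  have hdue' : ∀ i k, (C.task i).level = Level.HC →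
      R.release i k + (C.task i).D ≤ t - (C.task i).D →
      R.demand i k ≤ R.executed i k (R.release i k + (C.task i).D) := fun i k hi h =>
    hdue i k hi (by linarith [(C.task i).D_pos])
  have hD₀ := (C.task i₀).D_pos
  have hDL₀ := (C.task i₀).DL_pos
  -- Tightened deadlines at `t` itself are settled before the full ones, whose window ends after `t`
  -- and so contains them.
  have htightmiss : ∀ i k, (C.task i).level = Level.HC → R.release i k + (C.task i).DL = t →
      t ≤ e i → min (R.demand i k) (C.task i).CL ≤ R.executed i k t := by
    intro i k hi hr he
    have hDL := (C.task i).DL_pos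
    by_contra! hc
    refine hR.no_deficit hE hetE hsw hin hswe hdem htight hdue' hc (by linarith)
      (fun u h1 h2 => ⟨⟨h1, ?_, fun hl => ?_⟩, ?_⟩) (fun hl => ?_)
      (fun _ => ⟨?_, hr.le, fun _ => ⟨min_le_right _ _, he⟩, fun _ => min_le_right _ _,
        fun _ => min_le_right _ _, fun _ => min_le_right _ _⟩)
    · exact ((R.executed_mono i k h2.le).trans_lt hc).trans_le (min_le_left _ _)
    · rw [hi] at hl; cases hl
    · unfold Run.currentDeadline
      rw [if_neg fun hh => absurd ((hin i u).1 hh).2 (not_le.2 (h2.trans_le he))]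
      exact hr.le
    · rw [hi] at hl; cases hl
    · exact (min_le_right _ _).trans (C.task i).CH_ge_CL
  rcases hmiss with ⟨hi, hr, hd, hc⟩ | ⟨hi, hr, he, hc⟩ | ⟨hi, hr, hc⟩
  · refine hR.no_deficit hE hetE hsw hin hswe hdem htight hdue' hc (by linarith)
      (fun u h1 h2 => ⟨⟨h1, ?_, fun _ => ?_⟩, ?_⟩)
      (fun _ => ⟨(hR.demand_le i₀ k₀).trans ((C.task i₀).CL_eq_CH_of_LC hi).ge, hr.le, hd⟩)
      (fun hl => ?_)
    · exact (R.executed_mono i₀ k₀ h2.le).trans_lt hc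
    · exact (WithTop.coe_lt_coe.2 h2).trans_le hd
    · unfold Run.currentDeadline
      have := (C.task i₀).DL_eq_D_of_LC hi
      split_ifs <;> linarith
    · rw [hi] at hl; cases hl
  · exact absurd (htightmiss i₀ k₀ hi hr he) (not_le.2 hc)
  -- With `DL = D`, a job needing more than `CL` may cause its switch exactly at `t`. A window
  -- ending at `t` would count it with `CL` only; ending slightly later puts the switch inside the
  -- window.
  · obtain ⟨b, htb, hb, hbD, hbDL⟩ := hR.exists_window_end t hc
    have htightb : ∀ i k, (C.task i).level = Level.HC → R.release i k + (C.task i).DL < b →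
        R.release i k + (C.task i).DL < e i →
        min (R.demand i k) (C.task i).CL ≤
          R.executed i k (R.release i k + (C.task i).DL) := by
      intro i k hi h1 h2
      rcases (hbDL i k h1).eq_or_lt with h | h
      · have := htightmiss i k hi h (h.ge.trans h2.le)
        rwa [h]
      · exact htight i k hi h h2
    have hDLD := (C.task i₀).DL_le_D
    have hsmall : R.release i₀ k₀ + (C.task i₀).DL < e i₀ → R.demand i₀ k₀ ≤ (C.task i₀).CL :=
      fun h => hR.demand_le_CL hi (hsw i₀) h (htightb i₀ k₀ hi (by linarith) h)
    refine hR.no_deficit hE hetE hsw hin hswe hdem htightb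
      (fun i k hi h => hdue i k hi (by linarith [hbD i])) hb (by linarith)
      (fun u h1 h2 => ⟨⟨h1, ?_, fun hl => ?_⟩, ?_⟩) (fun hl => ?_)
      (fun _ => ⟨hR.demand_le i₀ k₀, by linarith, fun h => ?_, hsmall, fun h => ?_,
        fun h => hsmall (by linarith)⟩)
    · exact (R.executed_mono i₀ k₀ h2.le).trans_lt hb
    · rw [hi] at hl; cases hl
    · unfold Run.currentDeadline
      split_ifs <;> linarith
    · rw [hi] at hl; cases hl
    · linarith
    · linarith [hbD i₀]

end MixedCriticality

end

theorem theorem3 {ι : Type*} [Fintype ι] (C : MixedCriticality.Component ι)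
    (I : MixedCriticality.MCPR) (hI : I.level = C.level)
    (htest : ∀ t : ℝ, 0 ≤ t → (t : WithTop ℝ) ≤ C.tMax I →
      ∀ tE : ℝ, 0 ≤ tE → tE ≤ t → ∀ tI : ℝ, 0 ≤ tI → tI ≤ tE →
        C.dbf t tE tI ≤ I.sbf tE t) :
    MixedCriticality.SchedulableInHCMode C I :=
  MixedCriticality.schedulableInHCMode_of_dbf_le_sbf C I htest
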